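/- Let $\mathcal M$ be a finite-dimensional smooth Riemannian manifold with Levi-Civita connection $\nabla$, let $V\subseteq\mathcal M\times\mathbb R$ be open and let $f\in C^4(V,\mathbb R)$. Write $\operatorname{grad} f(w,\lambda)$ and $\operatorname{Hess} f(w,\lambda)[\xi]=\nabla_\xi \operatorname{grad} f(w,\lambda)$ for the Riemannian gradient and Hessian of $f(\cdot,\lambda)$ at $w$, and, where the Hessian is invertible, $$t(w,\lambda)=-\operatorname{Hess} f(w,\lambda)^{-1}\Big[\tfrac{\partial}{\partial\lambda}\operatorname{grad} f(w,\lambda)\Big],\qquad n(w,\lambda)=-\operatorname{Hess} f(w,\lambda)^{-1}\big[\operatorname{grad} f(w,\lambda)\big].$$ Let $R:T\mathcal M\to\mathcal M$ be a retraction, i.e. a smooth map with $R_x(0_x)=x$ and $\mathrm D R_x(0_x)=\mathrm{Id}_{T_x\mathcal M}$ for all $x$. Let $\mathcal T$ be a vector transport, i.e. a family of linear maps $\mathcal T_{y\to x}:T_y\mathcal M\to T_x\mathcal M$ that depends smoothly on $(y,x)$ near the diagonal and satisfies $\mathcal T_{x\to x}=\mathrm{Id}$. Let $x(\lambda)$,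 $\lambda\in[0,1]$, be a solution curve: $x$ is a $C^1$ curve on an open interval containing $[0,1]$, and for all $\lambda\in[0,1]$ one has $(x(\lambda),\lambda)\in V$, $\operatorname{grad} f(x(\lambda),\lambda)=0$, and $\operatorname{Hess} f(x(\lambda),\lambda)$ has full rank. For a point $(x,\lambda)=(x(\lambda),\lambda)$ of this curve and $h$ near $0$ put $$y(h)=R_x(h\,t(x,\lambda)),\qquad z(h)=R_{y(h)}\big(n(y(h),\lambda+h)\big),$$ $$\delta(x,\lambda,h)=\|n(y(h),\lambda+h)\|,\qquad \kappa(x,\lambda,h)=\frac{\|n(z(h),\lambda+h)\|}{\|n(y(h),\lambda+h)\|},$$ and, if $t(x,\lambda)\neq0$, $$\alpha(x,\lambda,h)=\arccos\left\langle \frac{t(x,\lambda)}{\|t(x,\lambda)\|},\frac{\mathcal T_{y(h)\to x}\big(t(y(h),\lambda+h)\big)}{\big\|\mathcal T_{y(h)\to x}\big(t(y(h),\lambda+h)\big)\big\|}\right\rangle_x .$$ Assume that for every point $(x,\lambda)$ of the solution curve $$\frac{\mathrm D^2}{\mathrm dh^2}\,n(y(h),\lambda+h)\Big|_{h=0}\neq0,$$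 where $\mathrm D/\mathrm dh$ is the covariant derivative along the path $h\mapsto y(h)$. Then there exist real-valued functions $\delta_2(x,\lambda)$, $\kappa_2(x,\lambda)$, $\alpha_1(x,\lambda)$, depending only on $x$ and $\lambda$, such that for every point $(x,\lambda)$ of the solution curve, as $h\to0^+$: 1. $\delta(x,\lambda,h)=\delta_2(x,\lambda)\,h^2+O(h^3)$; 2. $\kappa(x,\lambda,h)=\kappa_2(x,\lambda)\,h^2+o(h^2)$; 3. if $t(x,\lambda)\neq0$, then $\alpha(x,\lambda,h)=\alpha_1(x,\lambda)\,h+O(h^2)$. -/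

import Mathlib

open Bundle Manifold Set Filter Topology Asymptotics
open scoped ContDiff

namespace RiemannianContinuation

noncomputable section

section Connection

variable {E : Type*} [NormedAddCommGroup E] [NormedSpace ℝ E]
  {M : Type*} [TopologicalSpace M] [ChartedSpace E M] [IsManifold 𝓘(ℝ, E) ∞ M]
  [RiemannianBundle (fun x : M ↦ TangentSpace 𝓘(ℝ, E) x)]

/-- The right-hand side of the Koszul formula, i.e. the expression that equals
`2 ⟨∇_X Y, Z⟩` at `x` for the Levi-Civita connection `∇`. -/
def koszul (X Y Z : Π x : M, TangentSpace 𝓘(ℝ, E) x) (x : M) : ℝ :=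
  mvfderiv 𝓘(ℝ, E) (fun p ↦ inner ℝ (Y p) (Z p)) x (X x)
    + mvfderiv 𝓘(ℝ, E) (fun p ↦ inner ℝ (X p) (Z p)) x (Y x)
    - mvfderiv 𝓘(ℝ, E) (fun p ↦ inner ℝ (X p) (Y p)) x (Z x)
    + inner ℝ (VectorField.mlieBracket 𝓘(ℝ, E) X Y x) (Z x)
    - inner ℝ (VectorField.mlieBracket 𝓘(ℝ, E) X Z x) (Y x)
    - inner ℝ (VectorField.mlieBracket 𝓘(ℝ, E) Y Z x) (X x)

theorem clm_ext_inner {x : M} {A B : TangentSpace 𝓘(ℝ, E) x →L[ℝ] TangentSpace 𝓘(ℝ, E) x}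
    (h : ∀ X Z : Π x : M, TangentSpace 𝓘(ℝ, E) x, MDiffAt (T% X) x → MDiffAt (T% Z) x →
      inner ℝ (A (X x)) (Z x) = inner ℝ (B (X x)) (Z x)) : A = B := by
  ext v
  refine ext_inner_right ℝ fun w ↦ ?_
  simpa using h (FiberBundle.extend E v) (FiberBundle.extend E w)
    (FiberBundle.mdifferentiableAt_extend ..) (FiberBundle.mdifferentiableAt_extend ..)

variable [IsContMDiffRiemannianBundle 𝓘(ℝ, E) ∞ E (fun x : M ↦ TangentSpace 𝓘(ℝ, E) x)]

theorem mdiffAt_inner {x : M} {Y Z : Π x : M, TangentSpace 𝓘(ℝ, E) x}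
    (hY : MDiffAt (T% Y) x) (hZ : MDiffAt (T% Z) x) :
    MDiffAt (fun p ↦ inner ℝ (Y p) (Z p)) x :=
  MDifferentiableAt.inner_bundle (IB := 𝓘(ℝ, E)) (F := E)
    (E := fun x : M ↦ TangentSpace 𝓘(ℝ, E) x) (b := fun x : M ↦ x) hY hZ

variable [FiniteDimensional ℝ E]

theorem koszul_smul_left {x : M} {X Y Z : Π x : M, TangentSpace 𝓘(ℝ, E) x} {g : M → ℝ}
    (hg : MDiffAt g x) (hX : MDiffAt (T% X) x) (hY : MDiffAt (T% Y) x) (hZ : MDiffAt (T% Z) x) :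
    koszul (g • X) Y Z x = g x * koszul X Y Z x := by
  have : CompleteSpace E := FiniteDimensional.complete ℝ E
  simp only [koszul, Pi.smul_apply', real_inner_smul_left, real_inner_smul_right,
    mvfderiv_fun_mul hg (mdiffAt_inner hX hZ), mvfderiv_fun_mul hg (mdiffAt_inner hX hY),
    VectorField.mlieBracket_smul_left hg hX, inner_add_left]
  simp [real_inner_comm]
  ring

theorem koszul_smul_right {x : M} {X Y Z : Π x : M, TangentSpace 𝓘(ℝ, E) x} {g : M → ℝ}
    (hg : MDiffAt g x) (hX : MDiffAt (T% X) x) (hY : MDiffAt (T% Y) x) (hZ : MDiffAt (T% Z) x) :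
    koszul X Y (g • Z) x = g x * koszul X Y Z x := by
  have : CompleteSpace E := FiniteDimensional.complete ℝ E
  simp only [koszul, Pi.smul_apply', real_inner_smul_left, real_inner_smul_right,
    mvfderiv_fun_mul hg (mdiffAt_inner hX hZ), mvfderiv_fun_mul hg (mdiffAt_inner hY hZ),
    VectorField.mlieBracket_smul_right hg hZ, inner_add_left]
  simp [real_inner_comm]
  ring

theorem koszul_smul_mid {x : M} {X Y Z : Π x : M, TangentSpace 𝓘(ℝ, E) x} {g : M → ℝ}
    (hg : MDiffAt g x) (hX : MDiffAt (T% X) x) (hY : MDiffAt (T% Y) x) (hZ : MDiffAt (T% Z) x) :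
    koszul X (g • Y) Z x
      = g x * koszul X Y Z x + 2 * (mvfderiv 𝓘(ℝ, E) g x (X x) * inner ℝ (Y x) (Z x)) := by
  have : CompleteSpace E := FiniteDimensional.complete ℝ E
  simp only [koszul, Pi.smul_apply', real_inner_smul_left, real_inner_smul_right,
    mvfderiv_fun_mul hg (mdiffAt_inner hX hY), mvfderiv_fun_mul hg (mdiffAt_inner hY hZ),
    VectorField.mlieBracket_smul_right hg hY, VectorField.mlieBracket_smul_left hg hY,
    inner_add_left]
  simp [real_inner_comm]
  ring

theorem koszul_add_left {x : M} {X X' Y Z : Π x : M, TangentSpace 𝓘(ℝ, E) x}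
    (hX : MDiffAt (T% X) x) (hX' : MDiffAt (T% X') x)
    (hY : MDiffAt (T% Y) x) (hZ : MDiffAt (T% Z) x) :
    koszul (X + X') Y Z x = koszul X Y Z x + koszul X' Y Z x := by
  have : CompleteSpace E := FiniteDimensional.complete ℝ E
  simp only [koszul, Pi.add_apply, inner_add_left, inner_add_right,
    mvfderiv_fun_add (mdiffAt_inner hX hZ) (mdiffAt_inner hX' hZ),
    mvfderiv_fun_add (mdiffAt_inner hX hY) (mdiffAt_inner hX' hY),
    VectorField.mlieBracket_add_left hX hX']
  simp
  ring

theorem koszul_add_right {x : M} {X Y Z Z' : Π x : M, TangentSpace 𝓘(ℝ, E) x}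
    (hX : MDiffAt (T% X) x) (hY : MDiffAt (T% Y) x)
    (hZ : MDiffAt (T% Z) x) (hZ' : MDiffAt (T% Z') x) :
    koszul X Y (Z + Z') x = koszul X Y Z x + koszul X Y Z' x := by
  have : CompleteSpace E := FiniteDimensional.complete ℝ E
  simp only [koszul, Pi.add_apply, inner_add_left, inner_add_right,
    mvfderiv_fun_add (mdiffAt_inner hX hZ) (mdiffAt_inner hX hZ'),
    mvfderiv_fun_add (mdiffAt_inner hY hZ) (mdiffAt_inner hY hZ'),
    VectorField.mlieBracket_add_right hZ hZ']
  simp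
  ring

theorem koszul_add_mid {x : M} {X Y Y' Z : Π x : M, TangentSpace 𝓘(ℝ, E) x}
    (hX : MDiffAt (T% X) x) (hY : MDiffAt (T% Y) x)
    (hY' : MDiffAt (T% Y') x) (hZ : MDiffAt (T% Z) x) :
    koszul X (Y + Y') Z x = koszul X Y Z x + koszul X Y' Z x := by
  have : CompleteSpace E := FiniteDimensional.complete ℝ E
  simp only [koszul, Pi.add_apply, inner_add_left, inner_add_right,
    mvfderiv_fun_add (mdiffAt_inner hX hY) (mdiffAt_inner hX hY'),
    mvfderiv_fun_add (mdiffAt_inner hY hZ) (mdiffAt_inner hY' hZ),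
    VectorField.mlieBracket_add_left hY hY', VectorField.mlieBracket_add_right hY hY']
  simp
  ring

theorem koszul_tensorial_left {x : M} {Y Z : Π x : M, TangentSpace 𝓘(ℝ, E) x}
    (hY : MDiffAt (T% Y) x) (hZ : MDiffAt (T% Z) x) :
    TensorialAt 𝓘(ℝ, E) E (fun X ↦ koszul X Y Z x) x where
  smul hg hX := koszul_smul_left hg hX hY hZ
  add hX hX' := koszul_add_left hX hX' hY hZ

theorem koszul_tensorial_right {x : M} {X Y : Π x : M, TangentSpace 𝓘(ℝ, E) x}
    (hX : MDiffAt (T% X) x) (hY : MDiffAt (T% Y) x) :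
    TensorialAt 𝓘(ℝ, E) E (fun Z ↦ koszul X Y Z x) x where
  smul hg hZ := koszul_smul_right hg hX hY hZ
  add hZ hZ' := koszul_add_right hX hY hZ hZ'

/-- The tangent spaces, with the norm given by the Riemannian metric, are complete. -/
instance completeSpace_tangentSpace (x : M) : CompleteSpace (TangentSpace 𝓘(ℝ, E) x) :=
  have : FiniteDimensional ℝ (TangentSpace 𝓘(ℝ, E) x) := inferInstanceAs (FiniteDimensional ℝ E)
  FiniteDimensional.complete ℝ (TangentSpace 𝓘(ℝ, E) x)

open scoped Classical in
/-- `∇_v Y` at `x` for the Levi-Civita connection: the vector of `T_xM` that represents the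
functional `Z ↦ koszul v Y Z / 2`. It is set to `0` if the vector field `Y` is not differentiable
at `x`. -/
def leviCivitaFun (Y : Π x : M, TangentSpace 𝓘(ℝ, E) x) (x : M) :
    TangentSpace 𝓘(ℝ, E) x →L[ℝ] TangentSpace 𝓘(ℝ, E) x :=
  if hY : MDiffAt (T% Y) x then
    ((InnerProductSpace.toDual ℝ
        (TangentSpace 𝓘(ℝ, E) x)).symm.toContinuousLinearEquiv.toContinuousLinearMap).comp
      ((1 / 2 : ℝ) • TensorialAt.mkHom₂ (I := 𝓘(ℝ, E)) (F := E) (F' := E)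
        (fun X Z ↦ koszul X Y Z x) x
        (fun _ hZ ↦ koszul_tensorial_left hY hZ) (fun _ hX ↦ koszul_tensorial_right hX hY))
  else 0

theorem inner_leviCivitaFun {x : M} {X Y Z : Π x : M, TangentSpace 𝓘(ℝ, E) x}
    (hX : MDiffAt (T% X) x) (hY : MDiffAt (T% Y) x) (hZ : MDiffAt (T% Z) x) :
    inner ℝ (leviCivitaFun Y x (X x)) (Z x) = (1 / 2 : ℝ) * koszul X Y Z x := by
  have h := TensorialAt.mkHom₂_apply (Φ := fun X Z ↦ koszul X Y Z x)
    (fun _ hZ ↦ koszul_tensorial_left hY hZ) (fun _ hX ↦ koszul_tensorial_right hX hY) hX hZ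
  rw [leviCivitaFun, dif_pos hY, ← h]
  simp [real_inner_smul_left, InnerProductSpace.toDual_symm_apply]

variable (E M) in
/-- The Levi-Civita (Riemannian) connection of `M`. -/
def leviCivita : CovariantDerivative 𝓘(ℝ, E) E (fun x : M ↦ TangentSpace 𝓘(ℝ, E) x) where
  toFun := leviCivitaFun
  isCovariantDerivativeOnUniv :=
    { add := by
        intro Y Y' x hY hY' _
        refine clm_ext_inner fun X Z hX hZ ↦ ?_
        have hs : MDiffAt (T% (Y + Y')) x := mdifferentiableAt_add_section hY hY'
        rw [inner_leviCivitaFun hX hs hZ, koszul_add_mid hX hY hY' hZ,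
          add_apply, inner_add_left, inner_leviCivitaFun hX hY hZ,
          inner_leviCivitaFun hX hY' hZ]
        ring
      leibniz := by
        intro Y g x hY hg _
        refine clm_ext_inner fun X Z hX hZ ↦ ?_
        have hs : MDiffAt (T% (g • Y)) x := hg.smul_section hY
        rw [inner_leviCivitaFun hX hs hZ, koszul_smul_mid hg hX hY hZ,
          add_apply, inner_add_left, smul_apply,
          ContinuousLinearMap.smulRight_apply, real_inner_smul_left, real_inner_smul_left,
          inner_leviCivitaFun hX hY hZ]
        ring }

/-- The connection is compatible with the metric. -/
theorem leviCivita_metric {x : M} {X Y Z : Π x : M, TangentSpace 𝓘(ℝ, E) x}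
    (hX : MDiffAt (T% X) x) (hY : MDiffAt (T% Y) x) (hZ : MDiffAt (T% Z) x) :
    mvfderiv 𝓘(ℝ, E) (fun p ↦ inner ℝ (Y p) (Z p)) x (X x)
      = inner ℝ (leviCivita E M Y x (X x)) (Z x) + inner ℝ (Y x) (leviCivita E M Z x (X x)) := by
  change _ = inner ℝ (leviCivitaFun Y x (X x)) (Z x) + inner ℝ (Y x) (leviCivitaFun Z x (X x))
  rw [real_inner_comm (leviCivitaFun Z x (X x)), inner_leviCivitaFun hX hY hZ,
    inner_leviCivitaFun hX hZ hY]
  simp only [koszul]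
  rw [VectorField.mlieBracket_swap_apply (V := Z) (W := Y)]
  simp [real_inner_comm]
  ring

/-- The connection is torsion-free. -/
theorem leviCivita_torsion : (leviCivita E M).torsion = 0 := by
  have : CompleteSpace E := FiniteDimensional.complete ℝ E
  rw [CovariantDerivative.torsion_eq_zero_iff]
  intro X Y x hX hY
  refine ext_inner_right ℝ fun w ↦ ?_
  have hZ : MDiffAt (T% (FiberBundle.extend E w)) x := FiberBundle.mdifferentiableAt_extend ..
  have h1 := inner_leviCivitaFun hX hY hZ
  have h2 := inner_leviCivitaFun hY hX hZ
  rw [FiberBundle.extend_apply_self] at h1 h2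
  change inner ℝ (leviCivitaFun Y x (X x) - leviCivitaFun X x (Y x)) w = _
  rw [inner_sub_left, h1, h2]
  simp only [koszul, FiberBundle.extend_apply_self]
  rw [VectorField.mlieBracket_swap_apply (V := Y) (W := X)]
  simp [real_inner_comm]
  ring

variable (E)

/-- The Riemannian gradient of `g` at `x`: the vector of `T_xM` representing the differential. -/
def grad (g : M → ℝ) (x : M) : TangentSpace 𝓘(ℝ, E) x :=
  (InnerProductSpace.toDual ℝ (TangentSpace 𝓘(ℝ, E) x)).symm (mvfderiv 𝓘(ℝ, E) g x)

/-- The Riemannian Hessian of `g` at `x`, i.e. the linear map `v ↦ ∇_v grad g` on `T_xM`. -/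
def hess (g : M → ℝ) (x : M) : TangentSpace 𝓘(ℝ, E) x →L[ℝ] TangentSpace 𝓘(ℝ, E) x :=
  leviCivita E M (grad E g) x

/-- The derivative with respect to the parameter, at `l`, of the curve `μ ↦ grad f(w, μ)` in the
fixed vector space `T_wM`. -/
def gradParamDeriv (f : M × ℝ → ℝ) (w : M) (l : ℝ) : TangentSpace 𝓘(ℝ, E) w :=
  deriv (fun μ : ℝ ↦ grad E (fun p ↦ f (p, μ)) w) l

/-- The prediction vector `t(w, l) = - Hess f(w, l)⁻¹ [∂ grad f(w, l) / ∂l]`. -/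
def predictionVector (f : M × ℝ → ℝ) (w : M) (l : ℝ) : TangentSpace 𝓘(ℝ, E) w :=
  -(hess E (fun p ↦ f (p, l)) w).inverse (gradParamDeriv E f w l)

/-- The Riemannian Newton update vector `n(w, l) = - Hess f(w, l)⁻¹ [grad f(w, l)]`. -/
def newtonVector (f : M × ℝ → ℝ) (w : M) (l : ℝ) : TangentSpace 𝓘(ℝ, E) w :=
  -(hess E (fun p ↦ f (p, l)) w).inverse (grad E (fun p ↦ f (p, l)) w)

variable {E}

/-- The covariant derivative `DX/dh` (for the Levi-Civita connection) of a vector field `X` along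
a curve `y` in `M`, at the parameter `h`. In the local frame `e_i` of `TM` given by the
trivialization at `y h`, where `X s = ∑ X^i(s) e_i(y s)`, it is
`∑ (X^i)'(h) e_i(y h) + ∑ X^i(h) ∇_{y'(h)} e_i`. The vector field `∑ X^i(h) e_i`, with
coefficients frozen at `h`, is `FiberBundle.extend E (X h)`. -/
def covDerivAlong (y : ℝ → M) (X : Π h : ℝ, TangentSpace 𝓘(ℝ, E) (y h)) (h : ℝ) :
    TangentSpace 𝓘(ℝ, E) (y h) :=
  (trivializationAt E (fun p : M ↦ TangentSpace 𝓘(ℝ, E) p) (y h)).symm (y h)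
      (deriv (fun s : ℝ ↦
        (trivializationAt E (fun p : M ↦ TangentSpace 𝓘(ℝ, E) p) (y h) ⟨y s, X s⟩).2) h)
    + leviCivita E M (FiberBundle.extend E (X h)) (y h)
        (mfderiv 𝓘(ℝ, ℝ) 𝓘(ℝ, E) y h (1 : ℝ))

/-- A `C¹` curve of critical points of `f(·, l)`, `l ∈ [0, 1]`, inside the domain `V` of `f`, along
which the Riemannian Hessian has full rank. -/
structure IsSolutionCurve (V : Set (M × ℝ)) (f : M × ℝ → ℝ) (x : ℝ → M) : Prop where
  contMDiffOn : ∃ J : Set ℝ, IsOpen J ∧ J.OrdConnected ∧ Icc 0 1 ⊆ J ∧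
    ContMDiffOn 𝓘(ℝ, ℝ) 𝓘(ℝ, E) 1 x J
  mem : ∀ l ∈ Icc (0 : ℝ) 1, (x l, l) ∈ V
  grad_eq_zero : ∀ l ∈ Icc (0 : ℝ) 1, grad E (fun p ↦ f (p, l)) (x l) = 0
  hess_isInvertible : ∀ l ∈ Icc (0 : ℝ) 1, (hess E (fun p ↦ f (p, l)) (x l)).IsInvertible

end Connection

section Retraction

variable {E : Type*} [NormedAddCommGroup E] [NormedSpace ℝ E]
  {M : Type*} [TopologicalSpace M] [ChartedSpace E M] [IsManifold 𝓘(ℝ, E) ∞ M]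

/-- A retraction: a smooth map `R : TM → M` with `R_x(0) = x` and `D R_x(0) = id`. -/
structure IsRetraction (R : TangentBundle 𝓘(ℝ, E) M → M) : Prop where
  contMDiff : ContMDiff 𝓘(ℝ, E).tangent 𝓘(ℝ, E) ∞ R
  map_zero : ∀ x : M, R ⟨x, 0⟩ = x
  hasMFDerivAt_zero : ∀ x : M, HasMFDerivAt 𝓘(ℝ, E) 𝓘(ℝ, E) (fun v : E ↦ R ⟨x, v⟩) 0
    (ContinuousLinearMap.id ℝ E)

/-- A vector transport, as a family of linear maps `𝒯_{y → x} : T_yM → T_xM` that is smooth near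
the diagonal of `M × M` (that is, `(v, x) ↦ 𝒯_{π(v) → x} v` is a smooth map `TM × M → TM` near the
pairs `(v, x)` with `v ∈ T_xM`) and satisfies `𝒯_{x → x} = id`. -/
structure IsVectorTransport
    (T : Π y x : M, TangentSpace 𝓘(ℝ, E) y →L[ℝ] TangentSpace 𝓘(ℝ, E) x) : Prop where
  contMDiffAt : ∀ (x : M) (v : TangentSpace 𝓘(ℝ, E) x),
    ContMDiffAt (𝓘(ℝ, E).tangent.prod 𝓘(ℝ, E)) 𝓘(ℝ, E).tangent ∞
      (fun p : TangentBundle 𝓘(ℝ, E) M × M ↦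
        (⟨p.2, T p.1.proj p.2 p.1.snd⟩ : TangentBundle 𝓘(ℝ, E) M))
      (⟨x, v⟩, x)
  map_self : ∀ x : M, T x x = ContinuousLinearMap.id ℝ (TangentSpace 𝓘(ℝ, E) x)

end Retraction

section Indicators

variable {E : Type*} [NormedAddCommGroup E] [NormedSpace ℝ E] [FiniteDimensional ℝ E]
  {M : Type*} [TopologicalSpace M] [ChartedSpace E M] [IsManifold 𝓘(ℝ, E) ∞ M]
  [RiemannianBundle (fun x : M ↦ TangentSpace 𝓘(ℝ, E) x)]
  [IsContMDiffRiemannianBundle 𝓘(ℝ, E) ∞ E (fun x : M ↦ TangentSpace 𝓘(ℝ, E) x)]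
  (f : M × ℝ → ℝ) (R : TangentBundle 𝓘(ℝ, E) M → M)
  (T : Π y x : M, TangentSpace 𝓘(ℝ, E) y →L[ℝ] TangentSpace 𝓘(ℝ, E) x)

/-- The tangential prediction path `y(h) = R_x(h t(x, l))`. -/
def predictionPath (x : M) (l h : ℝ) : M :=
  R ⟨x, h • predictionVector E f x l⟩

/-- The Newton update vector `n(y(h), l + h)`, a vector field along the prediction path. -/
def firstUpdate (x : M) (l h : ℝ) : TangentSpace 𝓘(ℝ, E) (predictionPath f R x l h) :=
  newtonVector E f (predictionPath f R x l h) (l + h)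

/-- The first Newton iterate `z(h) = R_{y(h)}(n(y(h), l + h))`. -/
def firstIterate (x : M) (l h : ℝ) : M :=
  R ⟨predictionPath f R x l h, firstUpdate f R x l h⟩

/-- The norm `δ(x, l, h)` of the first Newton update vector. -/
def delta (x : M) (l h : ℝ) : ℝ :=
  ‖firstUpdate f R x l h‖

/-- The first contraction rate `κ(x, l, h)` of the Newton method. -/
def kappa (x : M) (l h : ℝ) : ℝ :=
  ‖newtonVector E f (firstIterate f R x l h) (l + h)‖ / ‖firstUpdate f R x l h‖

/-- The prediction vector `t(y(h), l + h)` transported to `T_xM`. -/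
def transportedPrediction (x : M) (l h : ℝ) : TangentSpace 𝓘(ℝ, E) x :=
  T (predictionPath f R x l h) x (predictionVector E f (predictionPath f R x l h) (l + h))

/-- The prediction angle `α(x, l, h)`. -/
def alpha (x : M) (l h : ℝ) : ℝ :=
  Real.arccos (inner ℝ (‖predictionVector E f x l‖⁻¹ • predictionVector E f x l)
    (‖transportedPrediction f R T x l h‖⁻¹ • transportedPrediction f R T x l h))

end Indicators

end

end RiemannianContinuation

/-
In a chart, a point `(x, l)` of the solution curve is a zero of the gradient. The prediction vector
`t` is chosen so that the gradient along `(y(h), l + h)` has vanishing derivative at `h = 0`, hence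
`n(y(h), l + h) = h² v + O(h³)`, which gives `δ`. A Newton step sends an update `n` to
`B(n, n) + o(‖n‖²)` for a bilinear map `B`, so `κ / h²` tends to `‖B(v, v)‖ / ‖v‖` if `v ≠ 0`. If
`v = 0`, then `κ = O(‖n‖) = O(h³)`. The tangent of the angle `α` is the norm of a `C²` curve that
vanishes at `h = 0`.
-/

namespace RiemannianContinuation

noncomputable section

section Chart

section ModelSpace

variable {E : Type*} [TopologicalSpace E] {M : Type*} [TopologicalSpace M] [ChartedSpace E M]

/-- The inverse of the chart at `x₀`, as a map defined on the whole model space. -/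
def chartInv (x₀ : M) (u : E) : M := (chartAt E x₀).symm u

theorem chartInv_mem_source {x₀ : M} {u : E} (hu : u ∈ (chartAt E x₀).target) :
    chartInv x₀ u ∈ (chartAt E x₀).source := (chartAt E x₀).map_target hu

theorem chartAt_chartInv {x₀ : M} {u : E} (hu : u ∈ (chartAt E x₀).target) :
    chartAt E x₀ (chartInv x₀ u) = u := (chartAt E x₀).right_inv hu

theorem chartInv_chartAt {x₀ p : M} (hp : p ∈ (chartAt E x₀).source) :
    chartInv x₀ (chartAt E x₀ p) = p := (chartAt E x₀).left_inv hp

theorem chart_target_mem_nhds {x₀ : M} {u : E} (hu : u ∈ (chartAt E x₀).target) :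
    (chartAt E x₀).target ∈ 𝓝 u := (chartAt E x₀).open_target.mem_nhds hu

theorem comp_chartAt_chartInv_eventuallyEq {F : Type*} {x₀ : M} {u : E}
    (hu : u ∈ (chartAt E x₀).target) (η : E → F) :
    (fun w ↦ η (chartAt E x₀ (chartInv x₀ w))) =ᶠ[𝓝 u] η := by
  filter_upwards [chart_target_mem_nhds hu] with w hw
  rw [chartAt_chartInv hw]

end ModelSpace

variable {E : Type*} [NormedAddCommGroup E] [NormedSpace ℝ E]
  {M : Type*} [TopologicalSpace M] [ChartedSpace E M] [IsManifold 𝓘(ℝ, E) ∞ M]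

theorem contMDiffOn_chartInv (x₀ : M) :
    ContMDiffOn 𝓘(ℝ, E) 𝓘(ℝ, E) ∞ (chartInv x₀) (chartAt E x₀).target :=
  contMDiffOn_chart_symm

theorem contMDiffAt_chartInv {x₀ : M} {u : E} (hu : u ∈ (chartAt E x₀).target) :
    ContMDiffAt 𝓘(ℝ, E) 𝓘(ℝ, E) ∞ (chartInv x₀) u :=
  (contMDiffOn_chartInv x₀).contMDiffAt (chart_target_mem_nhds hu)

theorem tendsto_chartInv (x₀ : M) : Tendsto (chartInv x₀) (𝓝 (chartAt E x₀ x₀)) (𝓝 x₀) := by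
  have h := (contMDiffAt_chartInv (mem_chart_target E x₀)).continuousAt.tendsto
  rwa [chartInv_chartAt (mem_chart_source E x₀)] at h

theorem contMDiffAt_chartAt {x₀ p : M} (hp : p ∈ (chartAt E x₀).source) :
    ContMDiffAt 𝓘(ℝ, E) 𝓘(ℝ, E) ∞ (chartAt E x₀) p :=
  contMDiffOn_chart.contMDiffAt ((chartAt E x₀).open_source.mem_nhds hp)

theorem mdifferentiableAt_comp_chartAt {F : Type*} [NormedAddCommGroup F] [NormedSpace ℝ F]
    {x₀ : M} {u : E} (hu : u ∈ (chartAt E x₀).target) {η : E → F}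
    (hη : DifferentiableAt ℝ η u) :
    MDiffAt (fun q ↦ η (chartAt E x₀ q)) (chartInv x₀ u) := by
  refine MDifferentiableAt.comp (I' := 𝓘(ℝ, E)) (chartInv x₀ u) (g := η) ?_
    ((contMDiffAt_chartAt (chartInv_mem_source hu)).mdifferentiableAt (by simp))
  rw [chartAt_chartInv hu]
  exact hη.mdifferentiableAt

/-- The vector of `T_pM` with coordinates `v` in the chart at `x₀`, as a function of `v`. -/
def chartFrame (x₀ p : M) : E →L[ℝ] TangentSpace 𝓘(ℝ, E) p :=
  (trivializationAt E (TangentSpace 𝓘(ℝ, E)) x₀).symmL ℝ p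

/-- The coordinates of a vector of `T_pM` in the chart at `x₀`. -/
def chartCoord (x₀ p : M) : TangentSpace 𝓘(ℝ, E) p →L[ℝ] E :=
  (trivializationAt E (TangentSpace 𝓘(ℝ, E)) x₀).continuousLinearMapAt ℝ p

theorem chartCoord_chartFrame {x₀ p : M} (hp : p ∈ (chartAt E x₀).source) (v : E) :
    chartCoord x₀ p (chartFrame x₀ p v) = v :=
  (trivializationAt E (TangentSpace 𝓘(ℝ, E)) x₀).continuousLinearMapAt_symmL hp v

theorem chartFrame_chartCoord {x₀ p : M} (hp : p ∈ (chartAt E x₀).source)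
    (v : TangentSpace 𝓘(ℝ, E) p) : chartFrame x₀ p (chartCoord x₀ p v) = v :=
  (trivializationAt E (TangentSpace 𝓘(ℝ, E)) x₀).symmL_continuousLinearMapAt hp v

/-- The linear isomorphism `T_pM ≃ E` given by the chart at `x₀`. -/
def chartEquiv {x₀ p : M} (hp : p ∈ (chartAt E x₀).source) : TangentSpace 𝓘(ℝ, E) p ≃L[ℝ] E :=
  ContinuousLinearEquiv.equivOfInverse (chartCoord x₀ p) (chartFrame x₀ p)
    (chartFrame_chartCoord hp) (chartCoord_chartFrame hp)

theorem chartCoord_eq {x₀ p : M} (hp : p ∈ (chartAt E x₀).source) (v : TangentSpace 𝓘(ℝ, E) p) :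
    chartCoord x₀ p v = (trivializationAt E (TangentSpace 𝓘(ℝ, E)) x₀ ⟨p, v⟩).2 :=
  (trivializationAt E (TangentSpace 𝓘(ℝ, E)) x₀).continuousLinearMapAt_apply_of_mem ℝ hp v

theorem contMDiffOn_chartFrame (x₀ : M) (v : E) :
    ContMDiffOn 𝓘(ℝ, E) 𝓘(ℝ, E).tangent ∞
      (fun p ↦ (⟨p, chartFrame x₀ p v⟩ : TangentBundle 𝓘(ℝ, E) M)) (chartAt E x₀).source := by
  refine ((trivializationAt E (TangentSpace 𝓘(ℝ, E)) x₀).contMDiffOn_section_baseSet_iff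
    (IB := 𝓘(ℝ, E)) (n := ∞) (s := fun p ↦ chartFrame x₀ p v)).2 ?_
  refine (contMDiffOn_const (c := v)).congr fun p hp ↦ ?_
  rw [← chartCoord_eq hp, chartCoord_chartFrame hp]

theorem contMDiffAt_chartFrame {x₀ p : M} (hp : p ∈ (chartAt E x₀).source) (v : E) :
    ContMDiffAt 𝓘(ℝ, E) 𝓘(ℝ, E).tangent ∞
      (fun p ↦ (⟨p, chartFrame x₀ p v⟩ : TangentBundle 𝓘(ℝ, E) M)) p :=
  (contMDiffOn_chartFrame x₀ v).contMDiffAt ((chartAt E x₀).open_source.mem_nhds hp)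

theorem mdifferentiableAt_chartFrame {x₀ p : M} (hp : p ∈ (chartAt E x₀).source) (v : E) :
    MDiffAt (T% (fun p : M ↦ chartFrame x₀ p v)) p :=
  (contMDiffAt_chartFrame hp v).mdifferentiableAt (by simp)

theorem mfderiv_chartInv {x₀ : M} {u : E} (hu : u ∈ (chartAt E x₀).target) :
    mfderiv 𝓘(ℝ, E) 𝓘(ℝ, E) (chartInv x₀) u
      = (chartFrame (E := E) x₀ (chartInv x₀ u) :
        E →L[ℝ] TangentSpace 𝓘(ℝ, E) (chartInv x₀ u)) := by
  have h := TangentBundle.symmL_trivializationAt (I := 𝓘(ℝ, E)) (chartInv_mem_source hu)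
  simp only [modelWithCornersSelf_coe, range_id, mfderivWithin_univ] at h
  rw [show extChartAt 𝓘(ℝ, E) x₀ (chartInv x₀ u) = u from chartAt_chartInv hu] at h
  exact h.symm

theorem mfderiv_chartAt {x₀ p : M} (hp : p ∈ (chartAt E x₀).source) :
    mfderiv 𝓘(ℝ, E) 𝓘(ℝ, E) (chartAt E x₀) p
      = (chartCoord (E := E) x₀ p : TangentSpace 𝓘(ℝ, E) p →L[ℝ] E) :=
  (TangentBundle.continuousLinearMapAt_trivializationAt (I := 𝓘(ℝ, E)) hp).symm

theorem mvfderiv_chartFrame {F : Type*} [NormedAddCommGroup F] [NormedSpace ℝ F] {x₀ : M} {u : E}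
    (hu : u ∈ (chartAt E x₀).target) {g : M → F} (hg : MDiffAt g (chartInv x₀ u)) (v : E) :
    mvfderiv 𝓘(ℝ, E) g (chartInv x₀ u) (chartFrame x₀ (chartInv x₀ u) v)
      = fderiv ℝ (fun w ↦ g (chartInv x₀ w)) u v := by
  have hchain := mfderiv_comp (I := 𝓘(ℝ, E)) (I' := 𝓘(ℝ, E)) (I'' := 𝓘(ℝ, F)) u hg
    ((contMDiffAt_chartInv hu).mdifferentiableAt (by simp))
  rw [mfderiv_chartInv hu] at hchain
  rw [← mfderiv_eq_fderiv, show (fun w ↦ g (chartInv x₀ w)) = g ∘ chartInv x₀ from rfl, hchain]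
  rfl

theorem contDiffOn_comp_chartInv {F : Type*} [NormedAddCommGroup F] [NormedSpace ℝ F] {x₀ : M}
    {g : M → F} (hg : ContMDiffOn 𝓘(ℝ, E) 𝓘(ℝ, F) ∞ g (chartAt E x₀).source) :
    ContDiffOn ℝ ∞ (fun u ↦ g (chartInv x₀ u)) (chartAt E x₀).target :=
  contMDiffOn_iff_contDiffOn.1 (hg.comp (contMDiffOn_chartInv x₀) fun _ ↦ chartInv_mem_source)

/-- The coordinates of the vector field `Y` in the chart at `x₀`, as a function on the model
space. -/
def chartField (x₀ : M) (Y : Π p : M, TangentSpace 𝓘(ℝ, E) p) (u : E) : E :=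
  chartCoord x₀ (chartInv x₀ u) (Y (chartInv x₀ u))

theorem chartFrame_chartField {x₀ p : M} (hp : p ∈ (chartAt E x₀).source)
    (Y : Π p : M, TangentSpace 𝓘(ℝ, E) p) :
    chartFrame x₀ p (chartField x₀ Y (chartAt E x₀ p)) = Y p := by
  rw [chartField, chartInv_chartAt hp, chartFrame_chartCoord hp]

theorem chartFrame_sum_eventuallyEq {ι : Type*} [Fintype ι] (b : Module.Basis ι ℝ E) {x₀ p : M}
    (hp : p ∈ (chartAt E x₀).source) (Y : Π p : M, TangentSpace 𝓘(ℝ, E) p) :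
    ∀ᶠ q in 𝓝 p, Y q
      = ∑ i, b.coord i (chartField x₀ Y (chartAt E x₀ q)) • chartFrame x₀ q (b i) := by
  filter_upwards [(chartAt E x₀).open_source.mem_nhds hp] with q hq
  calc Y q = chartFrame x₀ q (∑ i, b.repr (chartField x₀ Y (chartAt E x₀ q)) i • b i) := by
        rw [b.sum_repr, chartFrame_chartField hq]
    _ = _ := by simp only [map_sum, map_smul, Module.Basis.coord_apply]

theorem mdifferentiableAt_of_chartField {x₀ : M} {u : E} (hu : u ∈ (chartAt E x₀).target)
    {Y : Π p : M, TangentSpace 𝓘(ℝ, E) p} (hY : DifferentiableAt ℝ (chartField x₀ Y) u) :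
    MDiffAt (T% Y) (chartInv x₀ u) := by
  have hp := chartInv_mem_source hu
  refine ((trivializationAt E (TangentSpace 𝓘(ℝ, E)) x₀).mdifferentiableAt_section_iff
    𝓘(ℝ, E) Y hp).2 ((mdifferentiableAt_comp_chartAt hu hY).congr_of_eventuallyEq ?_)
  filter_upwards [(chartAt E x₀).open_source.mem_nhds hp] with q hq
  rw [← chartCoord_eq hq, chartField, chartInv_chartAt hq]

end Chart

theorem covariantDerivative_sum {𝕜 : Type*} [NontriviallyNormedField 𝕜] {E : Type*}
    [NormedAddCommGroup E] [NormedSpace 𝕜 E] {H : Type*} [TopologicalSpace H]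
    {I : ModelWithCorners 𝕜 E H} {M : Type*} [TopologicalSpace M] [ChartedSpace H M]
    {F : Type*} [NormedAddCommGroup F] [NormedSpace 𝕜 F] {V : M → Type*}
    [TopologicalSpace (TotalSpace F V)] [∀ x, AddCommGroup (V x)] [∀ x, Module 𝕜 (V x)]
    [∀ x, TopologicalSpace (V x)] [∀ x, IsTopologicalAddGroup (V x)]
    [∀ x, ContinuousSMul 𝕜 (V x)] [FiberBundle F V] [VectorBundle 𝕜 F V]
    (cov : CovariantDerivative I F V) {ι : Type*} (s : Finset ι) {σ : ι → Π x : M, V x} {x : M}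
    (hσ : ∀ i, MDiffAt (T% (σ i)) x) :
    cov (fun y ↦ ∑ i ∈ s, σ i y) x = ∑ i ∈ s, cov (σ i) x := by
  classical
  induction s using Finset.induction_on with
  | empty => simpa only [Finset.sum_empty] using! congrFun cov.zero x
  | insert i s hi ih =>
    simp only [Finset.sum_insert hi, ← ih]
    exact cov.isCovariantDerivativeOnUniv.add (hσ i) (.sum_section fun i _ ↦ hσ i)

section Metric

variable {E : Type*} [NormedAddCommGroup E] [NormedSpace ℝ E]
  {M : Type*} [TopologicalSpace M] [ChartedSpace E M] [IsManifold 𝓘(ℝ, E) ∞ M]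
  [RiemannianBundle (fun x : M ↦ TangentSpace 𝓘(ℝ, E) x)]

/-- The metric in the chart at `x₀`. -/
def chartMetric (x₀ : M) (u : E) : E →L[ℝ] E →L[ℝ] ℝ :=
  (innerSL ℝ : TangentSpace 𝓘(ℝ, E) (chartInv x₀ u) →L[ℝ]
    TangentSpace 𝓘(ℝ, E) (chartInv x₀ u) →L[ℝ] ℝ).bilinearComp
    (chartFrame x₀ (chartInv x₀ u)) (chartFrame x₀ (chartInv x₀ u))

theorem chartMetric_apply (x₀ : M) (u v w : E) :
    chartMetric x₀ u v w
      = inner ℝ (chartFrame x₀ (chartInv x₀ u) v) (chartFrame x₀ (chartInv x₀ u) w) := rfl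

variable [FiniteDimensional ℝ E]

theorem isInvertible_chartMetric {x₀ : M} {u : E} (hu : u ∈ (chartAt E x₀).target) :
    (chartMetric x₀ u).IsInvertible := by
  have hinj : Function.Injective (chartMetric x₀ u).toLinearMap := by
    refine (injective_iff_map_eq_zero _).2 fun v hv ↦ ?_
    have h0 : chartMetric x₀ u v v = 0 := by
      have : chartMetric x₀ u v = 0 := hv
      simp [this]
    rw [chartMetric_apply, inner_self_eq_zero] at h0
    have := chartCoord_chartFrame (chartInv_mem_source hu) v
    rw [h0, map_zero] at this
    exact this.symm
  have hdim : Module.finrank ℝ E = Module.finrank ℝ (E →L[ℝ] ℝ) := by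
    rw [← (LinearMap.toContinuousLinearMap (𝕜 := ℝ) (E := E) (F' := ℝ)).finrank_eq]
    exact (Subspace.dual_finrank_eq).symm
  exact ⟨(LinearEquiv.ofInjectiveOfFinrankEq _ hinj hdim).toContinuousLinearEquiv, by ext; rfl⟩

variable [IsContMDiffRiemannianBundle 𝓘(ℝ, E) ∞ E (fun x : M ↦ TangentSpace 𝓘(ℝ, E) x)]

theorem contDiffOn_chartMetric (x₀ : M) :
    ContDiffOn ℝ ∞ (chartMetric x₀) (chartAt E x₀).target := by
  refine contDiffOn_clm_apply.2 fun v ↦ contDiffOn_clm_apply.2 fun w ↦ ?_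
  have := ContMDiffOn.inner_bundle (IB := 𝓘(ℝ, E)) (n := ∞) (F := E)
    (E := fun x : M ↦ TangentSpace 𝓘(ℝ, E) x) (b := fun x : M ↦ x) (contMDiffOn_chartFrame x₀ v)
    (contMDiffOn_chartFrame x₀ w)
  exact contDiffOn_comp_chartInv this

theorem contDiffOn_inverse_chartMetric (x₀ : M) :
    ContDiffOn ℝ ∞ (fun u ↦ (chartMetric x₀ u).inverse) (chartAt E x₀).target := by
  have : CompleteSpace E := FiniteDimensional.complete ℝ E
  intro u hu
  exact ((isInvertible_chartMetric hu).contDiffAt_map_inverse).comp_contDiffWithinAt u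
    (contDiffOn_chartMetric x₀ u hu)

end Metric

section Connection

variable {E : Type*} [NormedAddCommGroup E] [NormedSpace ℝ E] [FiniteDimensional ℝ E]
  {M : Type*} [TopologicalSpace M] [ChartedSpace E M] [IsManifold 𝓘(ℝ, E) ∞ M]
  [RiemannianBundle (fun x : M ↦ TangentSpace 𝓘(ℝ, E) x)]
  [IsContMDiffRiemannianBundle 𝓘(ℝ, E) ∞ E (fun x : M ↦ TangentSpace 𝓘(ℝ, E) x)]

/-- The endomorphism `ξ ↦ ∇_ξ Y` in the chart at `x₀`, where `Y` has constant coordinates `v`. -/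
def chartConnection (x₀ : M) (v u : E) : E →L[ℝ] E :=
  (chartCoord x₀ (chartInv x₀ u)).comp
    ((leviCivita E M (fun p ↦ chartFrame x₀ p v) (chartInv x₀ u)).comp
      (chartFrame x₀ (chartInv x₀ u)))

/-- The Christoffel symbols in the chart at `x₀`. -/
def christoffel (x₀ : M) (u : E) : E →L[ℝ] E →L[ℝ] E :=
  ∑ i, ((Module.finBasis ℝ E).coord i).toContinuousLinearMap.smulRight
    (chartConnection x₀ (Module.finBasis ℝ E i) u)

theorem christoffel_apply (x₀ : M) (u v w : E) :
    christoffel x₀ u v w = ∑ i, (Module.finBasis ℝ E).coord i v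
      • chartConnection x₀ (Module.finBasis ℝ E i) u w := by
  simp only [christoffel, sum_apply, ContinuousLinearMap.smulRight_apply, smul_apply]
  rfl

theorem contDiffOn_mvfderiv_inner_chartFrame (x₀ : M) (v w z : E) :
    ContDiffOn ℝ ∞ (fun u ↦ mvfderiv 𝓘(ℝ, E)
        (fun p ↦ inner ℝ (chartFrame x₀ p v) (chartFrame x₀ p w)) (chartInv x₀ u)
        (chartFrame x₀ (chartInv x₀ u) z)) (chartAt E x₀).target := by
  have h1 : ContDiffOn ℝ ∞ (fun u ↦ chartMetric x₀ u v w) (chartAt E x₀).target :=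
    ((contDiffOn_chartMetric x₀).clm_apply contDiffOn_const).clm_apply contDiffOn_const
  have h2 := h1.fderiv_of_isOpen (m := ∞) (chartAt E x₀).open_target (by simp)
  refine (h2.clm_apply (contDiffOn_const (c := z))).congr fun u hu ↦ ?_
  have hp := chartInv_mem_source hu
  exact mvfderiv_chartFrame hu (mdiffAt_inner (mdifferentiableAt_chartFrame hp v)
    (mdifferentiableAt_chartFrame hp w)) z

theorem contDiffOn_inner_mlieBracket_chartFrame (x₀ : M) (v w z : E) :
    ContDiffOn ℝ ∞ (fun u ↦ inner ℝ (VectorField.mlieBracket 𝓘(ℝ, E)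
        (fun p ↦ chartFrame x₀ p v) (fun p ↦ chartFrame x₀ p w) (chartInv x₀ u))
        (chartFrame x₀ (chartInv x₀ u) z)) (chartAt E x₀).target := by
  have : CompleteSpace E := FiniteDimensional.complete ℝ E
  have : IsManifold 𝓘(ℝ, E) (minSmoothness ℝ 2) M := by
    rw [minSmoothness_of_isRCLikeNormedField]
    infer_instance
  have : IsManifold 𝓘(ℝ, E) (((⊤ : ℕ∞) : ℕ∞ω) + 1) M := inferInstanceAs (IsManifold 𝓘(ℝ, E) ∞ M)
  have h1 : ContMDiffOn 𝓘(ℝ, E) 𝓘(ℝ, E).tangent ∞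
      (fun p ↦ (⟨p, VectorField.mlieBracket 𝓘(ℝ, E)
        (fun p ↦ chartFrame x₀ p v) (fun p ↦ chartFrame x₀ p w) p⟩ : TangentBundle 𝓘(ℝ, E) M))
      (chartAt E x₀).source := fun p hp ↦
    (ContMDiffAt.mlieBracket_vectorField (m := ⊤) (n := ⊤) (contMDiffAt_chartFrame hp v)
      (contMDiffAt_chartFrame hp w) (by simp)).contMDiffWithinAt
  have := ContMDiffOn.inner_bundle (IB := 𝓘(ℝ, E)) (n := ∞) (F := E)
    (E := fun x : M ↦ TangentSpace 𝓘(ℝ, E) x) (b := fun x : M ↦ x) h1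
    (contMDiffOn_chartFrame x₀ z)
  exact contDiffOn_comp_chartInv this

theorem contDiffOn_koszul_chartFrame (x₀ : M) (v w z : E) :
    ContDiffOn ℝ ∞ (fun u ↦ koszul (fun p ↦ chartFrame x₀ p v) (fun p ↦ chartFrame x₀ p w)
      (fun p ↦ chartFrame x₀ p z) (chartInv x₀ u)) (chartAt E x₀).target := by
  unfold koszul
  exact ((((contDiffOn_mvfderiv_inner_chartFrame x₀ w z v).add
    (contDiffOn_mvfderiv_inner_chartFrame x₀ v z w)).sub
    (contDiffOn_mvfderiv_inner_chartFrame x₀ v w z)).add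
    (contDiffOn_inner_mlieBracket_chartFrame x₀ v w z)).sub
    (contDiffOn_inner_mlieBracket_chartFrame x₀ v z w) |>.sub
    (contDiffOn_inner_mlieBracket_chartFrame x₀ w z v)

theorem contDiffOn_chartConnection (x₀ : M) (v : E) :
    ContDiffOn ℝ ∞ (chartConnection x₀ v) (chartAt E x₀).target := by
  refine contDiffOn_clm_apply.2 fun z ↦ ?_
  have h1 : ContDiffOn ℝ ∞ (fun u ↦ chartMetric x₀ u (chartConnection x₀ v u z))
      (chartAt E x₀).target := by
    refine contDiffOn_clm_apply.2 fun w ↦ ?_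
    refine (contDiffOn_const (c := (1 / 2 : ℝ)) |>.mul
      (contDiffOn_koszul_chartFrame x₀ z v w)).congr fun u hu ↦ ?_
    have hp := chartInv_mem_source hu
    rw [← inner_leviCivitaFun (mdifferentiableAt_chartFrame hp z)
      (mdifferentiableAt_chartFrame hp v) (mdifferentiableAt_chartFrame hp w), chartMetric_apply]
    congr 1
    exact chartFrame_chartCoord hp _
  refine ((contDiffOn_inverse_chartMetric x₀).clm_apply h1).congr fun u hu ↦ ?_
  exact ((isInvertible_chartMetric hu).inverse_apply_eq.2 rfl).symm

theorem contDiffOn_christoffel (x₀ : M) :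
    ContDiffOn ℝ ∞ (christoffel x₀) (chartAt E x₀).target := by
  unfold christoffel
  exact ContDiffOn.sum fun i _ ↦ contDiffOn_const.smulRight (contDiffOn_chartConnection x₀ _)

theorem chartCoord_leviCivita_smul_chartFrame {x₀ : M} {u : E} (hu : u ∈ (chartAt E x₀).target)
    {g : E → ℝ} (hg : DifferentiableAt ℝ g u) (w v : E) :
    chartCoord x₀ (chartInv x₀ u)
        (leviCivita E M ((fun q ↦ g (chartAt E x₀ q)) • fun q ↦ chartFrame x₀ q w) (chartInv x₀ u)
          (chartFrame x₀ (chartInv x₀ u) v))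
      = fderiv ℝ g u v • w + g u • chartConnection x₀ w u v := by
  have hp := chartInv_mem_source hu
  have hgM := mdifferentiableAt_comp_chartAt hu hg
  have hd : mvfderiv 𝓘(ℝ, E) (fun q ↦ g (chartAt E x₀ q)) (chartInv x₀ u)
      (chartFrame x₀ (chartInv x₀ u) v) = fderiv ℝ g u v := by
    rw [mvfderiv_chartFrame hu hgM, (comp_chartAt_chartInv_eventuallyEq hu g).fderiv_eq]
  rw [(leviCivita E M).isCovariantDerivativeOnUniv.leibniz (mdifferentiableAt_chartFrame hp w) hgM]
  simp only [add_apply, smul_apply, ContinuousLinearMap.smulRight_apply, hd, map_add, map_smul,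
    chartCoord_chartFrame hp, chartAt_chartInv hu]
  exact add_comm _ _

theorem chartCoord_leviCivita {x₀ : M} {u : E} (hu : u ∈ (chartAt E x₀).target)
    {Y : Π p : M, TangentSpace 𝓘(ℝ, E) p} (hY : DifferentiableAt ℝ (chartField x₀ Y) u) (v : E) :
    chartCoord x₀ (chartInv x₀ u)
        (leviCivita E M Y (chartInv x₀ u) (chartFrame x₀ (chartInv x₀ u) v))
      = fderiv ℝ (chartField x₀ Y) u v + christoffel x₀ u (chartField x₀ Y u) v := by
  let b := Module.finBasis ℝ E
  let g (i) (w : E) : ℝ := b.coord i (chartField x₀ Y w)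
  have hg (i) : HasFDerivAt (g i)
      ((b.coord i).toContinuousLinearMap ∘L fderiv ℝ (chartField x₀ Y) u) u :=
    (b.coord i).toContinuousLinearMap.hasFDerivAt.comp u hY.hasFDerivAt
  have hsec (i) : MDiffAt
      (T% ((fun q ↦ g i (chartAt E x₀ q)) • fun q ↦ chartFrame x₀ q (b i))) (chartInv x₀ u) :=
    (mdifferentiableAt_comp_chartAt hu (hg i).differentiableAt).smul_section
      (mdifferentiableAt_chartFrame (chartInv_mem_source hu) (b i))
  have hsum := (leviCivita E M).isCovariantDerivativeOnUniv.congr_of_eventuallyEq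
    (mdifferentiableAt_of_chartField hu hY) (.sum_section fun i _ ↦ hsec i) univ_mem
    (chartFrame_sum_eventuallyEq b (chartInv_mem_source hu) Y)
  have hfderiv : fderiv ℝ (chartField x₀ Y) u v = ∑ i, fderiv ℝ (g i) u v • b i := by
    simp only [(hg _).fderiv]
    exact (b.sum_repr _).symm
  rw [hsum, covariantDerivative_sum _ _ hsec, hfderiv, christoffel_apply, sum_apply, map_sum,
    ← Finset.sum_add_distrib]
  exact Finset.sum_congr rfl fun i _ ↦
    chartCoord_leviCivita_smul_chartFrame hu (hg i).differentiableAt (b i) v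

end Connection

theorem fderiv_comp_prodMk_left {𝕜 : Type*} [NontriviallyNormedField 𝕜] {E F G : Type*}
    [NormedAddCommGroup E] [NormedSpace 𝕜 E] [NormedAddCommGroup F] [NormedSpace 𝕜 F]
    [NormedAddCommGroup G] [NormedSpace 𝕜 G] {g : E × F → G} {u : E} {w : F}
    (hg : DifferentiableAt 𝕜 g (u, w)) :
    fderiv 𝕜 (fun v ↦ g (v, w)) u = fderiv 𝕜 g (u, w) ∘L .inl 𝕜 E F :=
  (hg.hasFDerivAt.comp u (hasFDerivAt_prodMk_left u w)).fderiv

section ChartFun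

variable {E : Type*} [NormedAddCommGroup E] [NormedSpace ℝ E]
  {M : Type*} [TopologicalSpace M] [ChartedSpace E M]

/-- The function `f` in the chart at `x₀`. -/
def chartFun (f : M × ℝ → ℝ) (x₀ : M) (q : E × ℝ) : ℝ := f (chartInv x₀ q.1, q.2)

variable [IsManifold 𝓘(ℝ, E) ∞ M] {f : M × ℝ → ℝ} {x₀ : M}

theorem contDiffAt_chartFun {n : ℕ∞ω} [hn : ENat.LEInfty n] {q : E × ℝ}
    (hq : q.1 ∈ (chartAt E x₀).target)
    (hf : ContMDiffAt (𝓘(ℝ, E).prod 𝓘(ℝ, ℝ)) 𝓘(ℝ, ℝ) n f (chartInv x₀ q.1, q.2)) :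
    ContDiffAt ℝ n (chartFun f x₀) q := by
  have hinv : ContMDiffAt 𝓘(ℝ, E × ℝ) (𝓘(ℝ, E).prod 𝓘(ℝ, ℝ)) n
      (fun q : E × ℝ ↦ (chartInv x₀ q.1, q.2)) q :=
    (((contMDiffAt_chartInv hq).of_le hn.out).comp q contDiff_fst.contMDiff.contMDiffAt).prodMk
      contDiff_snd.contMDiff.contMDiffAt
  exact contMDiffAt_iff_contDiffAt.1 (ContMDiffAt.comp q hf hinv)

theorem mdifferentiableAt_of_chartFun {u : E} {l : ℝ} (hu : u ∈ (chartAt E x₀).target)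
    (hf : DifferentiableAt ℝ (chartFun f x₀) (u, l)) :
    MDiffAt (fun p ↦ f (p, l)) (chartInv x₀ u) := by
  have hf' : DifferentiableAt ℝ (fun w ↦ chartFun f x₀ (w, l)) u :=
    hf.comp (g := chartFun f x₀) u (hasFDerivAt_prodMk_left u l).differentiableAt
  refine (mdifferentiableAt_comp_chartAt hu hf').congr_of_eventuallyEq ?_
  filter_upwards [(chartAt E x₀).open_source.mem_nhds (chartInv_mem_source hu)] with q hq
  rw [chartFun, chartInv_chartAt hq]

end ChartFun

section Newton

variable {E : Type*} [NormedAddCommGroup E] [NormedSpace ℝ E] [FiniteDimensional ℝ E]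
  {M : Type*} [TopologicalSpace M] [ChartedSpace E M] [IsManifold 𝓘(ℝ, E) ∞ M]
  [RiemannianBundle (fun x : M ↦ TangentSpace 𝓘(ℝ, E) x)]

/-- The gradient of `f` in the chart at `x₀`. -/
def chartGrad (f : M × ℝ → ℝ) (x₀ : M) (q : E × ℝ) : E :=
  (chartMetric x₀ q.1).inverse (fderiv ℝ (chartFun f x₀) q ∘L .inl ℝ E ℝ)

variable {f : M × ℝ → ℝ} {x₀ : M}

theorem chartField_grad {u : E} {l : ℝ} (hu : u ∈ (chartAt E x₀).target)
    (hf : DifferentiableAt ℝ (chartFun f x₀) (u, l)) :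
    chartField x₀ (grad E fun p ↦ f (p, l)) u = chartGrad f x₀ (u, l) := by
  refine ((isInvertible_chartMetric hu).inverse_apply_eq.2 ?_).symm
  ext w
  rw [chartField, chartMetric_apply, chartFrame_chartCoord (chartInv_mem_source hu), grad,
    InnerProductSpace.toDual_symm_apply,
    mvfderiv_chartFrame hu (mdifferentiableAt_of_chartFun hu hf)]
  exact (DFunLike.congr_fun (fderiv_comp_prodMk_left hf) w).symm

theorem eventually_chartField_grad {q : E × ℝ} (hq : q.1 ∈ (chartAt E x₀).target)
    (hf : ContDiffAt ℝ 1 (chartFun f x₀) q) :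
    ∀ᶠ q in 𝓝 q, chartField x₀ (grad E fun p ↦ f (p, q.2)) q.1 = chartGrad f x₀ q := by
  filter_upwards [continuousAt_fst.preimage_mem_nhds (chart_target_mem_nhds hq),
    hf.eventually (by simp)] with q hq hf
  exact chartField_grad hq (hf.differentiableAt one_ne_zero)

variable [IsContMDiffRiemannianBundle 𝓘(ℝ, E) ∞ E (fun x : M ↦ TangentSpace 𝓘(ℝ, E) x)]

/-- The Hessian of `f` in the chart at `x₀`. -/
def chartHess (f : M × ℝ → ℝ) (x₀ : M) (q : E × ℝ) : E →L[ℝ] E :=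
  fderiv ℝ (chartGrad f x₀) q ∘L .inl ℝ E ℝ + christoffel x₀ q.1 (chartGrad f x₀ q)

/-- The Newton update vector in the chart at `x₀`. -/
def chartNewton (f : M × ℝ → ℝ) (x₀ : M) (q : E × ℝ) : E :=
  -(chartHess f x₀ q).inverse (chartGrad f x₀ q)

/-- The prediction vector in the chart at `x₀`. -/
def chartPrediction (f : M × ℝ → ℝ) (x₀ : M) (q : E × ℝ) : E :=
  -(chartHess f x₀ q).inverse (fderiv ℝ (chartGrad f x₀) q (0, 1))

theorem contDiffAt_chartGrad {n m : ℕ∞ω} [hm : ENat.LEInfty m] {q : E × ℝ}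
    (hq : q.1 ∈ (chartAt E x₀).target) (hf : ContDiffAt ℝ n (chartFun f x₀) q)
    (hmn : m + 1 ≤ n) : ContDiffAt ℝ m (chartGrad f x₀) q := by
  have hG : ContDiffAt ℝ m (fun q : E × ℝ ↦ (chartMetric x₀ q.1).inverse) q :=
    (((contDiffOn_inverse_chartMetric x₀).contDiffAt (chart_target_mem_nhds hq)).of_le
      hm.out).comp q contDiffAt_fst
  exact hG.clm_apply ((hf.fderiv_right hmn).clm_comp contDiffAt_const)

theorem contDiffAt_chartHess {n m : ℕ∞ω} [hm : ENat.LEInfty m] {q : E × ℝ}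
    (hq : q.1 ∈ (chartAt E x₀).target) (hg : ContDiffAt ℝ n (chartGrad f x₀) q)
    (hmn : m + 1 ≤ n) : ContDiffAt ℝ m (chartHess f x₀) q := by
  have hΓ : ContDiffAt ℝ m (fun q : E × ℝ ↦ christoffel x₀ q.1) q :=
    (((contDiffOn_christoffel x₀).contDiffAt (chart_target_mem_nhds hq)).of_le
      hm.out).comp q contDiffAt_fst
  exact ((hg.fderiv_right hmn).clm_comp contDiffAt_const).add
    (hΓ.clm_apply (hg.of_le (le_self_add.trans hmn)))

theorem contDiffAt_inverse_chartHess {n m : ℕ∞ω} [ENat.LEInfty m] {q : E × ℝ}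
    (hq : q.1 ∈ (chartAt E x₀).target) (hg : ContDiffAt ℝ n (chartGrad f x₀) q)
    (hmn : m + 1 ≤ n) (hH : (chartHess f x₀ q).IsInvertible) :
    ContDiffAt ℝ m (fun q ↦ (chartHess f x₀ q).inverse) q := by
  have : CompleteSpace E := FiniteDimensional.complete ℝ E
  exact hH.contDiffAt_map_inverse.comp q (contDiffAt_chartHess hq hg hmn)

theorem contDiffAt_chartNewton {n m : ℕ∞ω} [ENat.LEInfty m] {q : E × ℝ}
    (hq : q.1 ∈ (chartAt E x₀).target) (hg : ContDiffAt ℝ n (chartGrad f x₀) q)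
    (hmn : m + 1 ≤ n) (hH : (chartHess f x₀ q).IsInvertible) :
    ContDiffAt ℝ m (chartNewton f x₀) q :=
  ((contDiffAt_inverse_chartHess hq hg hmn hH).clm_apply
    (hg.of_le (le_self_add.trans hmn))).neg

theorem contDiffAt_chartPrediction {n m : ℕ∞ω} [ENat.LEInfty m] {q : E × ℝ}
    (hq : q.1 ∈ (chartAt E x₀).target) (hg : ContDiffAt ℝ n (chartGrad f x₀) q)
    (hmn : m + 1 ≤ n) (hH : (chartHess f x₀ q).IsInvertible) :
    ContDiffAt ℝ m (chartPrediction f x₀) q :=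
  ((contDiffAt_inverse_chartHess hq hg hmn hH).clm_apply
    ((hg.fderiv_right hmn).clm_apply contDiffAt_const)).neg

theorem chartCoord_hess {u : E} {l : ℝ} (hu : u ∈ (chartAt E x₀).target)
    (hf : ContDiffAt ℝ 2 (chartFun f x₀) (u, l)) (v : E) :
    chartCoord x₀ (chartInv x₀ u) (hess E (fun p ↦ f (p, l)) (chartInv x₀ u)
        (chartFrame x₀ (chartInv x₀ u) v)) = chartHess f x₀ (u, l) v := by
  have hg : DifferentiableAt ℝ (chartGrad f x₀) (u, l) :=
    (contDiffAt_chartGrad (m := 1) hu hf (by norm_num)).differentiableAt one_ne_zero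
  have hY : chartField x₀ (grad E fun p ↦ f (p, l)) =ᶠ[𝓝 u] fun w ↦ chartGrad f x₀ (w, l) :=
    (Continuous.prodMk_left l).continuousAt.eventually
      (eventually_chartField_grad hu (hf.of_le one_le_two))
  have hgl : DifferentiableAt ℝ (fun w ↦ chartGrad f x₀ (w, l)) u :=
    hg.comp (g := chartGrad f x₀) u (hasFDerivAt_prodMk_left u l).differentiableAt
  rw [hess, chartCoord_leviCivita hu (hgl.congr_of_eventuallyEq hY), hY.fderiv_eq, hY.eq_of_nhds,
    fderiv_comp_prodMk_left hg]
  rfl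

theorem hess_eq_conj_chartHess {u : E} {l : ℝ} (hu : u ∈ (chartAt E x₀).target)
    (hf : ContDiffAt ℝ 2 (chartFun f x₀) (u, l)) :
    hess E (fun p ↦ f (p, l)) (chartInv x₀ u)
      = (chartEquiv (chartInv_mem_source hu)).symm.toContinuousLinearMap ∘L
        chartHess f x₀ (u, l) ∘L
        (chartEquiv (E := E) (chartInv_mem_source hu)).toContinuousLinearMap := by
  have hp := chartInv_mem_source hu
  ext v
  change _ = chartFrame x₀ (chartInv x₀ u) (chartHess f x₀ (u, l) (chartCoord x₀ _ v))
  rw [← chartCoord_hess hu hf, chartFrame_chartCoord hp, chartFrame_chartCoord hp]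

theorem chartCoord_inverse_hess {u : E} {l : ℝ} (hu : u ∈ (chartAt E x₀).target)
    (hf : ContDiffAt ℝ 2 (chartFun f x₀) (u, l)) (v : TangentSpace 𝓘(ℝ, E) (chartInv x₀ u)) :
    chartCoord x₀ (chartInv x₀ u) ((hess E (fun p ↦ f (p, l)) (chartInv x₀ u)).inverse v)
      = (chartHess f x₀ (u, l)).inverse (chartCoord x₀ (chartInv x₀ u) v) := by
  rw [hess_eq_conj_chartHess hu hf, ContinuousLinearMap.inverse_equiv_comp,
    ContinuousLinearMap.inverse_comp_equiv]
  exact chartCoord_chartFrame (chartInv_mem_source hu) _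

theorem isInvertible_chartHess_iff {u : E} {l : ℝ} (hu : u ∈ (chartAt E x₀).target)
    (hf : ContDiffAt ℝ 2 (chartFun f x₀) (u, l)) :
    (chartHess f x₀ (u, l)).IsInvertible ↔
      (hess E (fun p ↦ f (p, l)) (chartInv x₀ u)).IsInvertible := by
  simp [hess_eq_conj_chartHess hu hf]

theorem chartCoord_newtonVector {u : E} {l : ℝ} (hu : u ∈ (chartAt E x₀).target)
    (hf : ContDiffAt ℝ 2 (chartFun f x₀) (u, l)) :
    chartCoord x₀ (chartInv x₀ u) (newtonVector E f (chartInv x₀ u) l)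
      = chartNewton f x₀ (u, l) := by
  have hgrad := chartField_grad hu (hf.differentiableAt two_ne_zero)
  rw [chartField] at hgrad
  rw [newtonVector, map_neg, chartCoord_inverse_hess hu hf, hgrad, chartNewton]

theorem chartCoord_gradParamDeriv {u : E} {l : ℝ} (hu : u ∈ (chartAt E x₀).target)
    (hf : ContDiffAt ℝ 2 (chartFun f x₀) (u, l)) :
    chartCoord x₀ (chartInv x₀ u) (gradParamDeriv E f (chartInv x₀ u) l)
      = fderiv ℝ (chartGrad f x₀) (u, l) (0, 1) := by
  have hp := chartInv_mem_source hu
  have hg : DifferentiableAt ℝ (chartGrad f x₀) (u, l) :=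
    (contDiffAt_chartGrad (m := 1) hu hf (by norm_num)).differentiableAt one_ne_zero
  have hderiv : HasDerivAt (fun μ ↦ chartFrame x₀ (chartInv x₀ u) (chartGrad f x₀ (u, μ)))
      (chartFrame x₀ (chartInv x₀ u) (fderiv ℝ (chartGrad f x₀) (u, l) (0, 1))) l :=
    (chartFrame (E := E) x₀ (chartInv x₀ u)).hasFDerivAt.comp_hasDerivAt l
      (hg.hasFDerivAt.comp_hasDerivAt l ((hasDerivAt_const l u).prodMk (hasDerivAt_id l)))
  have heq : (fun μ ↦ grad E (fun p ↦ f (p, μ)) (chartInv x₀ u)) =ᶠ[𝓝 l]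
      fun μ ↦ chartFrame x₀ (chartInv x₀ u) (chartGrad f x₀ (u, μ)) := by
    filter_upwards [(Continuous.prodMk_right u).continuousAt.eventually
      (eventually_chartField_grad hu (hf.of_le one_le_two))] with μ hμ
    rw [← hμ, chartField, chartFrame_chartCoord hp]
  rw [gradParamDeriv, (hderiv.congr_of_eventuallyEq heq).deriv, chartCoord_chartFrame hp]

theorem chartCoord_predictionVector {u : E} {l : ℝ} (hu : u ∈ (chartAt E x₀).target)
    (hf : ContDiffAt ℝ 2 (chartFun f x₀) (u, l)) :
    chartCoord x₀ (chartInv x₀ u) (predictionVector E f (chartInv x₀ u) l)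
      = chartPrediction f x₀ (u, l) := by
  rw [predictionVector, map_neg, chartCoord_inverse_hess hu hf, chartCoord_gradParamDeriv hu hf,
    chartPrediction]

end Newton

section Retraction

variable {E : Type*} [NormedAddCommGroup E] [NormedSpace ℝ E]
  {M : Type*} [TopologicalSpace M] [ChartedSpace E M] [IsManifold 𝓘(ℝ, E) ∞ M]

/-- The vector of `TM` with coordinates `(u, v)` in the chart at `x₀`. -/
def chartVector (x₀ : M) (q : E × E) : TangentBundle 𝓘(ℝ, E) M :=
  ⟨chartInv x₀ q.1, chartFrame x₀ (chartInv x₀ q.1) q.2⟩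

theorem chartVector_zero (x₀ : M) (u : E) :
    chartVector x₀ (u, 0) = ⟨chartInv x₀ u, 0⟩ := by
  rw [chartVector, map_zero]

theorem chartVector_chart_self (x₀ : M) (v : E) :
    chartVector x₀ (chartAt E x₀ x₀, v) = ⟨x₀, chartFrame x₀ x₀ v⟩ := by
  rw [chartVector, chartInv_chartAt (mem_chart_source E x₀)]

theorem contMDiffAt_chartVector {x₀ : M} {q : E × E} (hq : q.1 ∈ (chartAt E x₀).target) :
    ContMDiffAt 𝓘(ℝ, E × E) 𝓘(ℝ, E).tangent ∞ (chartVector x₀) q := by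
  have hmem : chartVector x₀ q ∈ (trivializationAt E (TangentSpace 𝓘(ℝ, E)) x₀).source :=
    (Trivialization.mem_source _).2 (chartInv_mem_source hq)
  refine ((trivializationAt E (TangentSpace 𝓘(ℝ, E)) x₀).contMDiffAt_iff
    (IB := 𝓘(ℝ, E)) hmem).2 ⟨?_, ?_⟩
  · exact (contMDiffAt_chartInv hq).comp q contDiff_fst.contMDiff.contMDiffAt
  · refine contDiff_snd.contMDiff.contMDiffAt.congr_of_eventuallyEq ?_
    filter_upwards [continuousAt_fst.preimage_mem_nhds (chart_target_mem_nhds hq)] with q hq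
    rw [chartVector, ← chartCoord_eq (chartInv_mem_source hq),
      chartCoord_chartFrame (chartInv_mem_source hq)]

/-- The retraction `R` in the chart at `x₀`. -/
def chartRetraction (R : TangentBundle 𝓘(ℝ, E) M → M) (x₀ : M) (q : E × E) : E :=
  chartAt E x₀ (R (chartVector x₀ q))

variable {R : TangentBundle 𝓘(ℝ, E) M → M}

namespace IsRetraction

theorem map_chartVector_zero (hR : IsRetraction R) (x₀ : M) (u : E) :
    R (chartVector x₀ (u, 0)) = chartInv x₀ u := by
  rw [chartVector_zero, hR.map_zero]

theorem chartRetraction_zero (hR : IsRetraction R) {x₀ : M} {u : E}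
    (hu : u ∈ (chartAt E x₀).target) : chartRetraction R x₀ (u, 0) = u := by
  rw [chartRetraction, hR.map_chartVector_zero, chartAt_chartInv hu]

theorem contMDiffAt_comp_chartVector (hR : IsRetraction R) {x₀ : M} {q : E × E}
    (hq : q.1 ∈ (chartAt E x₀).target) :
    ContMDiffAt 𝓘(ℝ, E × E) 𝓘(ℝ, E) ∞ (fun q ↦ R (chartVector x₀ q)) q :=
  ContMDiffAt.comp q hR.contMDiff.contMDiffAt (contMDiffAt_chartVector hq)

theorem eventually_chartInv_chartRetraction (hR : IsRetraction R) {x₀ : M} {u : E}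
    (hu : u ∈ (chartAt E x₀).target) :
    ∀ᶠ q in 𝓝 (u, (0 : E)), chartInv x₀ (chartRetraction R x₀ q) = R (chartVector x₀ q) := by
  have hcont := (hR.contMDiffAt_comp_chartVector (q := (u, (0 : E))) hu).continuousAt
  filter_upwards [hcont.preimage_mem_nhds ((chartAt E x₀).open_source.mem_nhds
    (by rw [hR.map_chartVector_zero]; exact chartInv_mem_source hu))] with q hq
  exact chartInv_chartAt hq

theorem contDiffAt_chartRetraction (hR : IsRetraction R) {x₀ : M} {u : E}
    (hu : u ∈ (chartAt E x₀).target) : ContDiffAt ℝ ∞ (chartRetraction R x₀) (u, 0) := by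
  refine contMDiffAt_iff_contDiffAt.1 (ContMDiffAt.comp (g := chartAt E x₀) (I' := 𝓘(ℝ, E)) _ ?_
    (hR.contMDiffAt_comp_chartVector hu))
  rw [hR.map_chartVector_zero]
  exact contMDiffAt_chartAt (chartInv_mem_source hu)

theorem hasFDerivAt_chartRetraction (hR : IsRetraction R) {x₀ : M} {u : E}
    (hu : u ∈ (chartAt E x₀).target) :
    HasFDerivAt (fun v ↦ chartRetraction R x₀ (u, v)) (ContinuousLinearMap.id ℝ E) 0 := by
  have hp := chartInv_mem_source hu
  let frame : E →L[ℝ] E :=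
    (chartFrame (E := E) x₀ (chartInv x₀ u) : E →L[ℝ] TangentSpace 𝓘(ℝ, E) (chartInv x₀ u))
  have hchart : HasMFDerivAt 𝓘(ℝ, E) 𝓘(ℝ, E) (chartAt E x₀) (R ⟨chartInv x₀ u, (0 : E)⟩)
      ((chartCoord (E := E) x₀ (chartInv x₀ u) :
        TangentSpace 𝓘(ℝ, E) (chartInv x₀ u) →L[ℝ] E) : E →L[ℝ] E) := by
    rw [← mfderiv_chartAt hp, show R ⟨chartInv x₀ u, (0 : E)⟩ = chartInv x₀ u from hR.map_zero _]
    exact ((contMDiffAt_chartAt hp).mdifferentiableAt (by simp)).hasMFDerivAt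
  have hfiber := hasMFDerivAt_iff_hasFDerivAt.1 (HasMFDerivAt.comp (0 : E) hchart
    (hR.hasMFDerivAt_zero (chartInv x₀ u)))
  rw [← _root_.map_zero frame] at hfiber
  refine (hfiber.comp (0 : E) frame.hasFDerivAt).congr_fderiv ?_
  ext v
  exact chartCoord_chartFrame hp v

end IsRetraction

theorem IsVectorTransport.contDiffAt_chartCoord
    {T : Π y x : M, TangentSpace 𝓘(ℝ, E) y →L[ℝ] TangentSpace 𝓘(ℝ, E) x}
    (hT : IsVectorTransport T) (x₀ : M) (v : E) :
    ContDiffAt ℝ ∞ (fun q : E × E ↦ chartCoord x₀ x₀ (T (chartInv x₀ q.1) x₀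
      (chartFrame x₀ (chartInv x₀ q.1) q.2))) (chartAt E x₀ x₀, v) := by
  have hx₀ := mem_chart_source E x₀
  obtain ⟨w, hw⟩ : ∃ w : TangentSpace 𝓘(ℝ, E) x₀,
      chartVector x₀ (chartAt E x₀ x₀, v) = ⟨x₀, w⟩ := by
    rw [chartVector, chartInv_chartAt hx₀]
    exact ⟨_, rfl⟩
  have htransport := ContMDiffAt.comp (chartAt E x₀ x₀, v) (hw ▸ hT.contMDiffAt x₀ w)
    ((contMDiffAt_chartVector (mem_chart_target E x₀)).prodMk contMDiffAt_const)
  refine contMDiffAt_iff_contDiffAt.1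
    ((contMDiffAt_totalSpace.1 htransport).2.congr_of_eventuallyEq (.of_eq ?_))
  ext q
  exact chartCoord_eq hx₀ _

end Retraction

section Norm

variable {E : Type*} [NormedAddCommGroup E] [NormedSpace ℝ E]
  {M : Type*} [TopologicalSpace M] [ChartedSpace E M] [IsManifold 𝓘(ℝ, E) ∞ M]
  [RiemannianBundle (fun x : M ↦ TangentSpace 𝓘(ℝ, E) x)]

/-- The Riemannian norm in the chart at `x₀`: the length at the point with coordinate `u` of the
tangent vector with coordinates `w`. -/
def chartNorm (x₀ : M) (u w : E) : ℝ :=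
  ‖chartFrame x₀ (chartInv x₀ u) w‖

theorem chartNorm_zero (x₀ : M) (u : E) : chartNorm x₀ u 0 = 0 := by
  rw [chartNorm, map_zero, norm_zero]

theorem chartNorm_smul (x₀ : M) (u : E) (c : ℝ) (w : E) :
    chartNorm x₀ u (c • w) = |c| * chartNorm x₀ u w := by
  rw [chartNorm, map_smul, norm_smul, Real.norm_eq_abs, chartNorm]

theorem abs_chartNorm_sub_le (x₀ : M) (u w w' : E) :
    |chartNorm x₀ u w - chartNorm x₀ u w'| ≤ chartNorm x₀ u (w - w') := by
  simp only [chartNorm, map_sub]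
  exact abs_norm_sub_norm_le _ _

theorem chartNorm_chartCoord {x₀ : M} {u : E} (hu : u ∈ (chartAt E x₀).target)
    (v : TangentSpace 𝓘(ℝ, E) (chartInv x₀ u)) :
    chartNorm x₀ u (chartCoord x₀ (chartInv x₀ u) v) = ‖v‖ := by
  rw [chartNorm, chartFrame_chartCoord (chartInv_mem_source hu)]

theorem chartNorm_pos {x₀ : M} {u w : E} (hu : u ∈ (chartAt E x₀).target) (hw : w ≠ 0) :
    0 < chartNorm x₀ u w := by
  refine norm_pos_iff.2 fun h ↦ hw ?_
  rw [← chartCoord_chartFrame (chartInv_mem_source hu) w, h, map_zero]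

theorem chartNorm_sub_mul_pow (x₀ : M) (u u₀ w a : E) (k : ℕ) {h : ℝ} (hh : 0 < h) :
    chartNorm x₀ u w - chartNorm x₀ u₀ a * h ^ k
      = (chartNorm x₀ u w - chartNorm x₀ u (h ^ k • a))
        + h ^ k * (chartNorm x₀ u a - chartNorm x₀ u₀ a) := by
  rw [chartNorm_smul, abs_of_pos (pow_pos hh k)]
  ring

section Asymptotics

variable [IsContMDiffRiemannianBundle 𝓘(ℝ, E) ∞ E (fun x : M ↦ TangentSpace 𝓘(ℝ, E) x)]
  {x₀ : M}

theorem isContinuousRiemannianBundle_tangentSpace :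
    IsContinuousRiemannianBundle E (fun x : M ↦ TangentSpace 𝓘(ℝ, E) x) := by
  obtain ⟨g, hg, hinner⟩ := IsContMDiffRiemannianBundle.exists_contMDiff (IB := 𝓘(ℝ, E)) (n := ∞)
    (F := E) (E := fun x : M ↦ TangentSpace 𝓘(ℝ, E) x)
  exact ⟨g, hg.continuous, hinner⟩

section Comparison

variable {ι : Type*} {F : Filter ι} {u : ι → E}

theorem isBigO_chartNorm (hu : Tendsto u F (𝓝 (chartAt E x₀ x₀))) (w : ι → E) :
    (fun i ↦ chartNorm x₀ (u i) (w i)) =O[F] w := by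
  have : IsContinuousRiemannianBundle E (fun x : M ↦ TangentSpace 𝓘(ℝ, E) x) :=
    isContinuousRiemannianBundle_tangentSpace
  obtain ⟨C, -, hC⟩ := eventually_norm_symmL_trivializationAt_lt E
    (fun x : M ↦ TangentSpace 𝓘(ℝ, E) x) x₀
  refine .of_bound C ((hu.eventually ((tendsto_chartInv x₀).eventually hC)).mono fun i hi ↦ ?_)
  rw [chartNorm, norm_norm]
  exact ContinuousLinearMap.le_of_opNorm_le _ hi.le (w i)

theorem isBigO_of_chartNorm (hu : Tendsto u F (𝓝 (chartAt E x₀ x₀))) (w : ι → E) :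
    w =O[F] fun i ↦ chartNorm x₀ (u i) (w i) := by
  have : IsContinuousRiemannianBundle E (fun x : M ↦ TangentSpace 𝓘(ℝ, E) x) :=
    isContinuousRiemannianBundle_tangentSpace
  obtain ⟨C, -, hC⟩ := eventually_norm_trivializationAt_lt E
    (fun x : M ↦ TangentSpace 𝓘(ℝ, E) x) x₀
  refine .of_bound C ?_
  filter_upwards [hu.eventually ((tendsto_chartInv x₀).eventually hC),
    hu.eventually (chart_target_mem_nhds (mem_chart_target E x₀))] with i hi hit
  rw [chartNorm, norm_norm]
  conv_lhs => rw [← chartCoord_chartFrame (chartInv_mem_source hit) (w i)]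
  exact ContinuousLinearMap.le_of_opNorm_le _ hi.le _

theorem isBigO_chartNorm_sub_chartNorm (hu : Tendsto u F (𝓝 (chartAt E x₀ x₀)))
    (w w' : ι → E) :
    (fun i ↦ chartNorm x₀ (u i) (w i) - chartNorm x₀ (u i) (w' i)) =O[F] fun i ↦ w i - w' i :=
  (IsBigO.of_norm_le fun i ↦ abs_chartNorm_sub_le x₀ (u i) (w i) (w' i)).trans
    (isBigO_chartNorm hu fun i ↦ w i - w' i)

end Comparison

variable [FiniteDimensional ℝ E]

theorem differentiableAt_chartNorm {u w : E} (hu : u ∈ (chartAt E x₀).target) (hw : w ≠ 0) :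
    DifferentiableAt ℝ (fun u ↦ chartNorm x₀ u w) u := by
  have hsq (u : E) : chartMetric x₀ u w w = chartNorm x₀ u w ^ 2 := by
    rw [chartMetric_apply, real_inner_self_eq_norm_sq, chartNorm]
  have hmetric : DifferentiableAt ℝ (fun u ↦ chartMetric x₀ u w w) u :=
    ((((contDiffOn_chartMetric x₀).contDiffAt (chart_target_mem_nhds hu)).differentiableAt
      (by simp)).clm_apply (differentiableAt_const w)).clm_apply (differentiableAt_const w)
  refine (hmetric.sqrt ?_).congr_of_eventuallyEq (.of_eq (funext fun u ↦ ?_))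
  · exact hsq u ▸ (pow_pos (chartNorm_pos hu hw) 2).ne'
  · rw [hsq, Real.sqrt_sq (by exact norm_nonneg _)]

theorem continuousAt_chartNorm {u : E} (hu : u ∈ (chartAt E x₀).target) (w : E) :
    ContinuousAt (fun u ↦ chartNorm x₀ u w) u := by
  rcases eq_or_ne w 0 with rfl | hw
  · simpa only [chartNorm_zero] using continuousAt_const
  · exact (differentiableAt_chartNorm hu hw).continuousAt

theorem isLittleO_chartNorm_sub {u w : ℝ → E} {a : E} {k : ℕ}
    (hu : Tendsto u (𝓝[>] 0) (𝓝 (chartAt E x₀ x₀)))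
    (hw : (fun h ↦ w h - h ^ k • a) =o[𝓝[>] 0] fun h ↦ h ^ k) :
    (fun h ↦ chartNorm x₀ (u h) (w h) - chartNorm x₀ (chartAt E x₀ x₀) a * h ^ k)
      =o[𝓝[>] 0] fun h ↦ h ^ k := by
  have hbase : (fun h ↦ chartNorm x₀ (u h) a - chartNorm x₀ (chartAt E x₀ x₀) a)
      =o[𝓝[>] 0] fun _ ↦ (1 : ℝ) :=
    (isLittleO_one_iff ℝ).2 (tendsto_sub_nhds_zero_iff.2
      ((continuousAt_chartNorm (mem_chart_target E x₀) a).tendsto.comp hu))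
  have hsum := ((isBigO_chartNorm_sub_chartNorm hu w fun h ↦ h ^ k • a).trans_isLittleO hw).add
    (by simpa only [mul_one] using (isBigO_refl (fun h : ℝ ↦ h ^ k) (𝓝[>] 0)).mul_isLittleO hbase)
  refine hsum.congr' ?_ .rfl
  filter_upwards [self_mem_nhdsWithin] with h hh
  exact (chartNorm_sub_mul_pow x₀ (u h) (chartAt E x₀ x₀) (w h) a k hh).symm

theorem isBigO_chartNorm_sub {u w : ℝ → E} {a : E} {k : ℕ}
    (hu : DifferentiableAt ℝ u 0) (hu₀ : u 0 = chartAt E x₀ x₀)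
    (hw : (fun h ↦ w h - h ^ k • a) =O[𝓝[>] 0] fun h ↦ h ^ (k + 1)) :
    (fun h ↦ chartNorm x₀ (u h) (w h) - chartNorm x₀ (chartAt E x₀ x₀) a * h ^ k)
      =O[𝓝[>] 0] fun h ↦ h ^ (k + 1) := by
  have hlim : Tendsto u (𝓝[>] 0) (𝓝 (chartAt E x₀ x₀)) :=
    hu₀ ▸ hu.continuousAt.tendsto.mono_left nhdsWithin_le_nhds
  have hbase : (fun h ↦ chartNorm x₀ (u h) a - chartNorm x₀ (chartAt E x₀ x₀) a)
      =O[𝓝[>] 0] fun h ↦ h := by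
    rcases eq_or_ne a 0 with rfl | ha
    · simpa only [chartNorm_zero, sub_zero] using isBigO_zero _ _
    · have hdiff := DifferentiableAt.comp (0 : ℝ)
        (hu₀.symm ▸ differentiableAt_chartNorm (mem_chart_target E x₀) ha) hu
      have hO := hdiff.isBigO_sub
      simp only [Function.comp_apply, hu₀, sub_zero] at hO
      exact hO.mono nhdsWithin_le_nhds
  have hsum := ((isBigO_chartNorm_sub_chartNorm hlim w fun h ↦ h ^ k • a).trans hw).add
    ((isBigO_refl (fun h : ℝ ↦ h ^ k) (𝓝[>] 0)).mul hbase)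
  refine hsum.congr' ?_ .rfl
  filter_upwards [self_mem_nhdsWithin] with h hh
  exact (chartNorm_sub_mul_pow x₀ (u h) (chartAt E x₀ x₀) (w h) a k hh).symm

end Asymptotics

end Norm

section Expansion

variable {F G : Type*} [NormedAddCommGroup F] [NormedSpace ℝ F] [NormedAddCommGroup G]
  [NormedSpace ℝ G]

section Taylor

theorem isBigO_sub_taylor {g : ℝ → F} {n : ℕ} (hg : ContDiffAt ℝ (n + 1) g 0) :
    (fun h ↦ g h - ∑ k ∈ Finset.range (n + 1),
      ((k.factorial : ℝ)⁻¹ * h ^ k) • iteratedDeriv k g 0) =O[𝓝 0] fun h ↦ h ^ (n + 1) := by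
  obtain ⟨s, hs, hgs⟩ := hg.contDiffOn (m := (n + 1 : ℕ)) (by norm_cast) (by simp)
  obtain ⟨r, hr, hball⟩ := Metric.mem_nhds_iff.1 hs
  have h0 : (0 : ℝ) ∈ Metric.ball 0 r := Metric.mem_ball_self hr
  have htaylor := (taylor_isLittleO (convex_ball _ r) h0 (hgs.mono hball)).isBigO
  rw [Metric.isOpen_ball.nhdsWithin_eq h0] at htaylor
  simp only [taylor_within_apply, sub_zero,
    iteratedDerivWithin_of_isOpen Metric.isOpen_ball h0] at htaylor
  have hlast : (fun h : ℝ ↦ (((n + 1).factorial : ℝ)⁻¹ * h ^ (n + 1)) • iteratedDeriv (n + 1) g 0)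
      =O[𝓝 0] fun h ↦ h ^ (n + 1) := by
    simp only [mul_smul]
    refine .const_smul_left ?_ _
    simpa only [smul_eq_mul, mul_one] using (isBigO_refl (fun h : ℝ ↦ h ^ (n + 1)) _).smul
      (isBigO_const_const (iteratedDeriv (n + 1) g 0) (one_ne_zero (α := ℝ)) _)
  refine (htaylor.add hlast).congr_left fun h ↦ ?_
  rw [Finset.sum_range_succ _ (n + 1)]
  abel

theorem isBigO_sub_smul_deriv {g : ℝ → F} (hg : ContDiffAt ℝ 2 g 0) (h0 : g 0 = 0) :
    (fun h ↦ g h - h • deriv g 0) =O[𝓝 0] fun h ↦ h ^ 2 := by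
  refine (isBigO_sub_taylor (n := 1) (by norm_cast)).congr_left fun h ↦ ?_
  simp [Finset.sum_range_succ, h0]

theorem exists_isBigO_sub_sq_smul {g : ℝ → F} (hg : ContDiffAt ℝ 3 g 0) (h0 : g 0 = 0)
    (h1 : deriv g 0 = 0) : ∃ a, (fun h ↦ g h - h ^ 2 • a) =O[𝓝 0] fun h ↦ h ^ 3 := by
  refine ⟨(2 : ℝ)⁻¹ • iteratedDeriv 2 g 0, ?_⟩
  refine (isBigO_sub_taylor (n := 2) (by norm_cast)).congr_left fun h ↦ ?_
  simp [Finset.sum_range_succ, h0, h1, smul_smul, mul_comm]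

theorem norm_sub_taylor_two_le {g : F → G} {p v : F} {Q : F →L[ℝ] F →L[ℝ] G} {ε : ℝ}
    (hg : ∀ s ∈ Icc (0 : ℝ) 1, DifferentiableAt ℝ g (p + s • v))
    (hQ : ∀ s ∈ Icc (0 : ℝ) 1, ‖fderiv ℝ g (p + s • v) - fderiv ℝ g p - Q (s • v)‖ ≤ ε * ‖v‖) :
    ‖g (p + v) - g p - fderiv ℝ g p v - (2 : ℝ)⁻¹ • Q v v‖ ≤ ε * ‖v‖ ^ 2 := by
  let k (s : ℝ) : G := g (p + s • v) - s • fderiv ℝ g p v - s ^ 2 • (2 : ℝ)⁻¹ • Q v v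
  have hk (s : ℝ) (hs : s ∈ Icc (0 : ℝ) 1) : HasDerivWithinAt k
      ((fderiv ℝ g (p + s • v) - fderiv ℝ g p - Q (s • v)) v) (Icc 0 1) s := by
    have hline : HasDerivAt (fun s : ℝ ↦ p + s • v) v s := by
      simpa using ((hasDerivAt_id s).smul_const v).const_add p
    refine ((((hg s hs).hasFDerivAt.comp_hasDerivAt s hline).sub
      ((hasDerivAt_id s).smul_const (fderiv ℝ g p v))).sub
      (((hasDerivAt_id s).pow 2).smul_const ((2 : ℝ)⁻¹ • Q v v))).hasDerivWithinAt.congr_deriv ?_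
    simp [smul_smul]
    ring_nf
  have hbound := norm_image_sub_le_of_norm_deriv_le_segment_01' hk fun s hs ↦
    ContinuousLinearMap.le_of_opNorm_le _ (hQ s (Ico_subset_Icc_self hs)) v
  convert hbound using 1
  · simp only [k]
    congr 1
    simp
    abel
  · ring

theorem isLittleO_sub_taylor_two {g : F → G} {p₀ : F} (hg : ContDiffAt ℝ 2 g p₀) :
    (fun q : F × F ↦ g (q.1 + q.2) - g q.1 - fderiv ℝ g q.1 q.2
      - (2 : ℝ)⁻¹ • fderiv ℝ (fderiv ℝ g) p₀ q.2 q.2) =o[𝓝 (p₀, 0)] fun q ↦ ‖q.2‖ ^ 2 := by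
  have hstrict : HasStrictFDerivAt (fderiv ℝ g) (fderiv ℝ (fderiv ℝ g) p₀) p₀ :=
    (hg.fderiv_right (m := 1) (by norm_num)).hasStrictFDerivAt (by simp)
  refine isLittleO_iff.2 fun ε hε ↦ ?_
  have hsegment : ∀ᶠ q : F × F in 𝓝 (p₀, 0), ∀ s ∈ Icc (0 : ℝ) 1,
      DifferentiableAt ℝ g (q.1 + s • q.2) ∧
        ‖fderiv ℝ g (q.1 + s • q.2) - fderiv ℝ g q.1
          - fderiv ℝ (fderiv ℝ g) p₀ (q.1 + s • q.2 - q.1)‖ ≤ ε * ‖q.1 + s • q.2 - q.1‖ := by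
    refine isCompact_Icc.eventually_forall_of_forall_eventually fun s _ ↦ ?_
    have hpoint : Tendsto (fun z : (F × F) × ℝ ↦ z.1.1 + z.2 • z.1.2) (𝓝 ((p₀, 0), s)) (𝓝 p₀) :=
      Continuous.tendsto' (by fun_prop) _ _ (by simp)
    have hbase : Tendsto (fun z : (F × F) × ℝ ↦ z.1.1) (𝓝 ((p₀, 0), s)) (𝓝 p₀) :=
      Continuous.tendsto' (by fun_prop) _ _ rfl
    exact (hpoint.eventually ((hg.eventually (by simp)).mono fun q hq ↦
      hq.differentiableAt (by simp))).and
        ((hpoint.prodMk_nhds hbase).eventually (hstrict.isLittleO.def hε))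
  filter_upwards [hsegment] with q hq
  rw [norm_pow, norm_norm]
  refine norm_sub_taylor_two_le (fun s hs ↦ (hq s hs).1) fun s hs ↦ ?_
  have hle := (hq s hs).2
  rw [add_sub_cancel_left] at hle
  refine hle.trans ?_
  gcongr
  rw [norm_smul, Real.norm_of_nonneg hs.1]
  exact mul_le_of_le_one_left (norm_nonneg _) hs.2

end Taylor

section Products

theorem isBigO_clm_apply_sub_pow_smul {A : ℝ → F →L[ℝ] G} {A₀ : F →L[ℝ] G} {a : ℝ → F} {a₀ : F}
    {k : ℕ} (hA : (fun h ↦ A h - A₀) =O[𝓝 0] fun h ↦ h)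
    (ha : (fun h ↦ a h - h ^ k • a₀) =O[𝓝 0] fun h ↦ h ^ (k + 1)) :
    (fun h ↦ A h (a h) - h ^ k • A₀ a₀) =O[𝓝 0] fun h ↦ h ^ (k + 1) := by
  have hlim : Tendsto A (𝓝 0) (𝓝 A₀) :=
    tendsto_sub_nhds_zero_iff.1 (hA.trans_tendsto tendsto_id)
  have hrest : (fun h ↦ A h (a h - h ^ k • a₀)) =O[𝓝 0] fun h ↦ h ^ (k + 1) :=
    ((isBoundedBilinearMap_apply (𝕜 := ℝ)).isBigO_comp).trans
      (by simpa only [one_mul] using ((hlim.isBigO_one ℝ).norm_left.mul ha.norm_left))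
  have hlead : (fun h ↦ h ^ k • (A h - A₀) a₀) =O[𝓝 0] fun h ↦ h ^ (k + 1) :=
    (isBigO_refl (fun h : ℝ ↦ h ^ k) _).smul
      (((ContinuousLinearMap.apply ℝ G a₀).isBigO_comp _ _).trans hA)
  refine (hrest.add hlead).congr_left fun h ↦ ?_
  simp only [map_sub, map_smul, sub_apply, smul_sub]
  abel

theorem isLittleO_clm_apply₂_sub {ι : Type*} {l : Filter ι} {B : ι → F →L[ℝ] F →L[ℝ] G}
    {B₀ : F →L[ℝ] F →L[ℝ] G} (hB : Tendsto B l (𝓝 B₀)) (n : ι → F) :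
    (fun i ↦ B i (n i) (n i) - B₀ (n i) (n i)) =o[l] fun i ↦ ‖n i‖ ^ 2 := by
  have hnorm : Tendsto (fun i ↦ ‖B i - B₀‖) l (𝓝 0) :=
    (tendsto_iff_norm_sub_tendsto_zero (E := F →L[ℝ] F →L[ℝ] G)).1 hB
  have hsmall : (fun i ↦ ‖B i - B₀‖ * ‖n i‖ ^ 2) =o[l] fun i ↦ ‖n i‖ ^ 2 := by
    simpa only [one_mul] using
      ((isLittleO_one_iff ℝ).2 hnorm).mul_isBigO (isBigO_refl (fun i ↦ ‖n i‖ ^ 2) l)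
  refine (IsBigO.of_norm_le fun i ↦ ?_).trans_isLittleO hsmall
  rw [sq, ← mul_assoc]
  exact (B i - B₀).le_opNorm₂ (n i) (n i)

theorem isBigO_clm_apply₂ {ι : Type*} {l : Filter ι} (B : F →L[ℝ] F →L[ℝ] G) (n : ι → F) :
    (fun i ↦ B (n i) (n i)) =O[l] fun i ↦ ‖n i‖ ^ 2 := by
  refine .of_bound ‖B‖ (.of_forall fun i ↦ (B.le_opNorm₂ (n i) (n i)).trans_eq ?_)
  rw [norm_pow, norm_norm, mul_assoc, sq]

theorem isLittleO_clm_apply_sub_clm_apply₂ {H ι : Type*} [NormedAddCommGroup H]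
    [NormedSpace ℝ H] {l : Filter ι} {A : ι → G →L[ℝ] H} {A₀ : G →L[ℝ] H} (hA : Tendsto A l (𝓝 A₀))
    {g : ι → G} {n : ι → F} {B : F →L[ℝ] F →L[ℝ] G}
    (hg : (fun i ↦ g i - B (n i) (n i)) =o[l] fun i ↦ ‖n i‖ ^ 2) :
    (fun i ↦ A i (g i) - A₀ (B (n i) (n i))) =o[l] fun i ↦ ‖n i‖ ^ 2 := by
  have hrest : (fun i ↦ A i (g i - B (n i) (n i))) =o[l] fun i ↦ ‖n i‖ ^ 2 :=
    ((isBoundedBilinearMap_apply (𝕜 := ℝ)).isBigO_comp).trans_isLittleO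
      (by simpa only [one_mul] using (hA.isBigO_one ℝ).norm_left.mul_isLittleO hg.norm_left)
  have hsmall : (fun i ↦ A i - A₀) =o[l] fun _ ↦ (1 : ℝ) :=
    (isLittleO_one_iff ℝ).2 (tendsto_sub_nhds_zero_iff.2 hA)
  have hlead : (fun i ↦ (A i - A₀) (B (n i) (n i))) =o[l] fun i ↦ ‖n i‖ ^ 2 :=
    ((isBoundedBilinearMap_apply (𝕜 := ℝ)).isBigO_comp).trans_isLittleO
      (by simpa only [one_mul] using hsmall.norm_left.mul_isBigO (isBigO_clm_apply₂ B n).norm_left)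
  refine (hrest.add hlead).congr_left fun i ↦ ?_
  simp only [map_sub, sub_apply]
  abel

theorem isBigO_pow_smul (v : F) (k : ℕ) (l : Filter ℝ) :
    (fun h : ℝ ↦ h ^ k • v) =O[l] fun h ↦ h ^ k := by
  simpa only [smul_eq_mul, mul_one] using (isBigO_refl (fun h : ℝ ↦ h ^ k) l).smul
    (isBigO_const_const v (one_ne_zero (α := ℝ)) l)

theorem isBigO_of_isLittleO_sub_pow_smul {n : ℝ → F} {v : F} {k : ℕ} {l : Filter ℝ}
    (hn : (fun h ↦ n h - h ^ k • v) =o[l] fun h ↦ h ^ k) : n =O[l] fun h ↦ h ^ k := by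
  simpa only [sub_add_cancel] using hn.isBigO.add (isBigO_pow_smul v k l)

theorem isLittleO_clm_apply₂_sub_pow_smul {B : F →L[ℝ] F →L[ℝ] G} {n : ℝ → F} {v : F}
    {k : ℕ} {l : Filter ℝ} (hn : (fun h ↦ n h - h ^ k • v) =o[l] fun h ↦ h ^ k) :
    (fun h ↦ B (n h) (n h) - h ^ (k + k) • B v v) =o[l] fun h ↦ h ^ (k + k) := by
  have hnO := isBigO_of_isLittleO_sub_pow_smul hn
  have hleft : (fun h ↦ B (n h - h ^ k • v) (n h)) =o[l] fun h ↦ h ^ k * h ^ k :=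
    B.isBoundedBilinearMap.isBigO_comp.trans_isLittleO
      (hn.norm_left.mul_isBigO hnO.norm_left)
  have hright : (fun h ↦ B (h ^ k • v) (n h - h ^ k • v)) =o[l] fun h ↦ h ^ k * h ^ k :=
    B.isBoundedBilinearMap.isBigO_comp.trans_isLittleO
      ((isBigO_pow_smul v k l).norm_left.mul_isLittleO hn.norm_left)
  simp only [pow_add]
  refine (hleft.add hright).congr_left fun h ↦ ?_
  simp only [map_sub, map_smul, sub_apply, smul_apply, smul_smul]
  abel

theorem isBigO_div_of_isBigO_sq {ι : Type*} {l : Filter ι} {a b : ι → ℝ}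
    (h : a =O[l] fun i ↦ b i ^ 2) : (fun i ↦ a i / b i) =O[l] b := by
  simpa only [div_eq_mul_inv, sq, mul_self_mul_inv] using h.mul (isBigO_refl (fun i ↦ (b i)⁻¹) l)

theorem isLittleO_sub_mul_pow_iff {a : ℝ → ℝ} {a₀ : ℝ} {k : ℕ} :
    (fun h ↦ a h - a₀ * h ^ k) =o[𝓝[>] 0] (fun h ↦ h ^ k) ↔
      Tendsto (fun h ↦ a h / h ^ k) (𝓝[>] 0) (𝓝 a₀) := by
  have hpos : ∀ᶠ h : ℝ in 𝓝[>] 0, h ^ k ≠ 0 := by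
    filter_upwards [self_mem_nhdsWithin] with h hh
    exact pow_ne_zero k (ne_of_gt hh)
  rw [isLittleO_iff_tendsto' (hpos.mono fun h hh h0 ↦ absurd h0 hh)]
  refine (tendsto_congr' (hpos.mono fun h hh ↦ ?_)).trans tendsto_sub_nhds_zero_iff
  rw [sub_div, mul_div_cancel_right₀ _ hh]

theorem isLittleO_div_sub_mul_pow {a b : ℝ → ℝ} {a₀ b₀ : ℝ} {j k : ℕ} (hb₀ : b₀ ≠ 0)
    (ha : (fun h ↦ a h - a₀ * h ^ (j + k)) =o[𝓝[>] 0] fun h ↦ h ^ (j + k))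
    (hb : (fun h ↦ b h - b₀ * h ^ k) =o[𝓝[>] 0] fun h ↦ h ^ k) :
    (fun h ↦ a h / b h - a₀ / b₀ * h ^ j) =o[𝓝[>] 0] fun h ↦ h ^ j := by
  rw [isLittleO_sub_mul_pow_iff] at ha hb ⊢
  refine (ha.div hb hb₀).congr' ?_
  filter_upwards [self_mem_nhdsWithin] with h hh
  have : h ≠ 0 := ne_of_gt hh
  simp only [Pi.div_apply, pow_add]
  field_simp

end Products

end Expansion

section NewtonStep

variable {E : Type*} [NormedAddCommGroup E] [NormedSpace ℝ E]
  {M : Type*} [TopologicalSpace M] [ChartedSpace E M] [IsManifold 𝓘(ℝ, E) ∞ M]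
  [RiemannianBundle (fun x : M ↦ TangentSpace 𝓘(ℝ, E) x)]

/-- The gradient of `f` after a retraction step, in the chart at `x₀`, as a function of the starting
point `p.1` (a coordinate together with the parameter) and of the step `p.2`. -/
def chartGradStep (f : M × ℝ → ℝ) (R : TangentBundle 𝓘(ℝ, E) M → M) (x₀ : M)
    (p : (E × ℝ) × E) : E :=
  chartGrad f x₀ (chartRetraction R x₀ (p.1.1, p.2), p.1.2)

variable {f : M × ℝ → ℝ} {R : TangentBundle 𝓘(ℝ, E) M → M} {x₀ : M} {q : E × ℝ}

theorem chartGradStep_zero (hR : IsRetraction R) (hq : q.1 ∈ (chartAt E x₀).target) :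
    chartGradStep f R x₀ (q, 0) = chartGrad f x₀ q := by
  rw [chartGradStep, hR.chartRetraction_zero hq]

theorem contDiffAt_chartGradStep {n : ℕ∞ω} [hn : ENat.LEInfty n] (hR : IsRetraction R)
    (hq : q.1 ∈ (chartAt E x₀).target) (hg : ContDiffAt ℝ n (chartGrad f x₀) q) :
    ContDiffAt ℝ n (chartGradStep f R x₀) (q, 0) := by
  have hstep : ContDiffAt ℝ n (fun p : (E × ℝ) × E ↦ chartRetraction R x₀ (p.1.1, p.2)) (q, 0) :=
    ContDiffAt.comp (g := chartRetraction R x₀) (q, (0 : E))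
      ((hR.contDiffAt_chartRetraction hq).of_le hn.out) (contDiffAt_fst.fst.prodMk contDiffAt_snd)
  refine ContDiffAt.comp (g := chartGrad f x₀) (q, (0 : E)) ?_ (hstep.prodMk contDiffAt_fst.snd)
  rwa [hR.chartRetraction_zero hq]

theorem fderiv_chartGradStep (hR : IsRetraction R) (hq : q.1 ∈ (chartAt E x₀).target)
    (hg : ContDiffAt ℝ 1 (chartGrad f x₀) q) (v : E) :
    fderiv ℝ (chartGradStep f R x₀) (q, 0) (0, v) = fderiv ℝ (chartGrad f x₀) q (v, 0) := by
  have hpartial : HasFDerivAt (fun w ↦ chartGradStep f R x₀ (q, w))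
      (fderiv ℝ (chartGradStep f R x₀) (q, 0) ∘L .inr ℝ (E × ℝ) E) 0 :=
    ((contDiffAt_chartGradStep hR hq hg).differentiableAt one_ne_zero).hasFDerivAt.comp (0 : E)
      (hasFDerivAt_prodMk_right q (0 : E))
  have hgrad : HasFDerivAt (chartGrad f x₀) (fderiv ℝ (chartGrad f x₀) q)
      (chartRetraction R x₀ (q.1, 0), q.2) := by
    rw [hR.chartRetraction_zero hq]
    exact (hg.differentiableAt one_ne_zero).hasFDerivAt
  have hcomp : HasFDerivAt (fun w ↦ chartGradStep f R x₀ (q, w)) _ 0 :=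
    hgrad.comp (0 : E) ((hR.hasFDerivAt_chartRetraction hq).prodMk (hasFDerivAt_const q.2 (0 : E)))
  exact DFunLike.congr_fun (hpartial.unique hcomp) v

variable [FiniteDimensional ℝ E]
  [IsContMDiffRiemannianBundle 𝓘(ℝ, E) ∞ E (fun x : M ↦ TangentSpace 𝓘(ℝ, E) x)]

/-- One Riemannian Newton step with the retraction `R`, in the chart at `x₀`; the parameter `q.2` is
kept fixed. -/
def chartNewtonStep (f : M × ℝ → ℝ) (R : TangentBundle 𝓘(ℝ, E) M → M) (x₀ : M) (q : E × ℝ) :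
    E × ℝ :=
  (chartRetraction R x₀ (q.1, chartNewton f x₀ q), q.2)

theorem chartHess_chartNewton (hH : (chartHess f x₀ q).IsInvertible) :
    chartHess f x₀ q (chartNewton f x₀ q) = -chartGrad f x₀ q := by
  rw [chartNewton, map_neg, ← hH.inverse_apply_eq.1 rfl]

theorem chartNewton_eq_zero (hgrad : chartGrad f x₀ q = 0) : chartNewton f x₀ q = 0 := by
  rw [chartNewton, hgrad, map_zero, neg_zero]

theorem chartGradStep_add_fderiv_chartNewton (hR : IsRetraction R)
    (hq : q.1 ∈ (chartAt E x₀).target) (hg : ContDiffAt ℝ 1 (chartGrad f x₀) q)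
    (hH : (chartHess f x₀ q).IsInvertible) :
    chartGradStep f R x₀ (q, 0) + fderiv ℝ (chartGradStep f R x₀) (q, 0) (0, chartNewton f x₀ q)
      = christoffel x₀ q.1 (chartHess f x₀ q (chartNewton f x₀ q)) (chartNewton f x₀ q) := by
  have hfderiv : fderiv ℝ (chartGrad f x₀) q (chartNewton f x₀ q, 0)
      = chartHess f x₀ q (chartNewton f x₀ q)
        - christoffel x₀ q.1 (chartGrad f x₀ q) (chartNewton f x₀ q) := by
    simp [chartHess]
  rw [chartGradStep_zero hR hq, fderiv_chartGradStep hR hq hg, hfderiv, chartHess_chartNewton hH,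
    map_neg, neg_apply]
  abel

theorem tendsto_chartNewton_nhds_zero (hq : q.1 ∈ (chartAt E x₀).target)
    (hg : ContDiffAt ℝ 1 (chartGrad f x₀) q) (hgrad : chartGrad f x₀ q = 0)
    (hH : (chartHess f x₀ q).IsInvertible) : Tendsto (chartNewton f x₀) (𝓝 q) (𝓝 0) := by
  simpa only [chartNewton_eq_zero hgrad] using
    (contDiffAt_chartNewton (m := 0) hq hg (by norm_num) hH).continuousAt.tendsto

theorem tendsto_chartNewtonStep (hR : IsRetraction R) (hq : q.1 ∈ (chartAt E x₀).target)
    (hg : ContDiffAt ℝ 1 (chartGrad f x₀) q) (hgrad : chartGrad f x₀ q = 0)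
    (hH : (chartHess f x₀ q).IsInvertible) :
    Tendsto (chartNewtonStep f R x₀) (𝓝 q) (𝓝 q) := by
  have hretr := (hR.contDiffAt_chartRetraction hq).continuousAt.tendsto
  rw [hR.chartRetraction_zero hq] at hretr
  exact (hretr.comp (continuousAt_fst.tendsto.prodMk_nhds
    (tendsto_chartNewton_nhds_zero hq hg hgrad hH))).prodMk_nhds continuousAt_snd

theorem eventually_isInvertible_chartHess (hq : q.1 ∈ (chartAt E x₀).target)
    (hg : ContDiffAt ℝ 1 (chartGrad f x₀) q) (hH : (chartHess f x₀ q).IsInvertible) :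
    ∀ᶠ q in 𝓝 q, (chartHess f x₀ q).IsInvertible := by
  have : CompleteSpace E := FiniteDimensional.complete ℝ E
  obtain ⟨e, he⟩ := hH
  have hcont := (contDiffAt_chartHess (m := 0) hq hg (by norm_num)).continuousAt
  exact hcont.eventually (he ▸ e.nhds)

theorem continuousAt_christoffel_comp_chartHess (hq : q.1 ∈ (chartAt E x₀).target)
    (hg : ContDiffAt ℝ 1 (chartGrad f x₀) q) :
    ContinuousAt (fun p : E × ℝ ↦ christoffel x₀ p.1 ∘L chartHess f x₀ p) q := by
  have hΓ : ContinuousAt (fun p : E × ℝ ↦ christoffel x₀ p.1) q :=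
    ((contDiffOn_christoffel x₀).contDiffAt (chart_target_mem_nhds hq)).continuousAt.comp
      continuousAt_fst
  exact hΓ.clm_comp (contDiffAt_chartHess (m := 0) hq hg (by norm_num)).continuousAt

theorem isLittleO_chartGrad_chartNewtonStep_sub_taylor (hR : IsRetraction R)
    (hq : q.1 ∈ (chartAt E x₀).target) (hg : ContDiffAt ℝ 2 (chartGrad f x₀) q)
    (hgrad : chartGrad f x₀ q = 0) (hH : (chartHess f x₀ q).IsInvertible) :
    (fun p ↦ chartGrad f x₀ (chartNewtonStep f R x₀ p)
      - chartGradStep f R x₀ (p, 0)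
      - fderiv ℝ (chartGradStep f R x₀) (p, 0) (0, chartNewton f x₀ p)
      - (2 : ℝ)⁻¹ • fderiv ℝ (fderiv ℝ (chartGradStep f R x₀)) (q, 0)
          (0, chartNewton f x₀ p) (0, chartNewton f x₀ p))
      =o[𝓝 q] fun p ↦ ‖chartNewton f x₀ p‖ ^ 2 := by
  have hN := tendsto_chartNewton_nhds_zero hq (hg.of_le one_le_two) hgrad hH
  have hlim : Tendsto (fun p ↦ ((p, (0 : E)), ((0 : E × ℝ), chartNewton f x₀ p))) (𝓝 q)
      (𝓝 ((q, 0), 0)) :=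
    (tendsto_id.prodMk_nhds tendsto_const_nhds).prodMk_nhds (tendsto_const_nhds.prodMk_nhds hN)
  have hstep (p : E × ℝ) : chartGradStep f R x₀ (p, chartNewton f x₀ p)
      = chartGrad f x₀ (chartNewtonStep f R x₀ p) := rfl
  simpa [Function.comp_def, hstep] using
    (isLittleO_sub_taylor_two (contDiffAt_chartGradStep hR hq hg)).comp_tendsto hlim

theorem exists_isLittleO_chartGrad_chartNewtonStep (hR : IsRetraction R)
    (hq : q.1 ∈ (chartAt E x₀).target) (hg : ContDiffAt ℝ 2 (chartGrad f x₀) q)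
    (hgrad : chartGrad f x₀ q = 0) (hH : (chartHess f x₀ q).IsInvertible) :
    ∃ B : E →L[ℝ] E →L[ℝ] E, (fun p ↦ chartGrad f x₀ (chartNewtonStep f R x₀ p)
      - B (chartNewton f x₀ p) (chartNewton f x₀ p)) =o[𝓝 q] fun p ↦ ‖chartNewton f x₀ p‖ ^ 2 := by
  have hg₁ : ContDiffAt ℝ 1 (chartGrad f x₀) q := hg.of_le one_le_two
  let D := fderiv ℝ (fderiv ℝ (chartGradStep f R x₀)) (q, 0)
  have hC := isLittleO_clm_apply₂_sub
    (continuousAt_christoffel_comp_chartHess hq hg₁).tendsto (chartNewton f x₀)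
  refine ⟨christoffel x₀ q.1 ∘L chartHess f x₀ q
    + (2 : ℝ)⁻¹ • D.bilinearComp (.inr ℝ (E × ℝ) E) (.inr ℝ (E × ℝ) E), ?_⟩
  refine ((isLittleO_chartGrad_chartNewtonStep_sub_taylor hR hq hg hgrad hH).add hC).congr' ?_ .rfl
  filter_upwards [eventually_isInvertible_chartHess hq hg₁ hH, hg₁.eventually (by simp),
    continuousAt_fst.preimage_mem_nhds (chart_target_mem_nhds hq)] with p hHp hgp hp
  have hfirst := chartGradStep_add_fderiv_chartNewton hR hp hgp hHp
  simp only [ContinuousLinearMap.comp_apply, ← hfirst]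
  simp [D]
  abel

theorem exists_isLittleO_chartNewton_chartNewtonStep (hR : IsRetraction R)
    (hq : q.1 ∈ (chartAt E x₀).target) (hg : ContDiffAt ℝ 2 (chartGrad f x₀) q)
    (hgrad : chartGrad f x₀ q = 0) (hH : (chartHess f x₀ q).IsInvertible) :
    ∃ B : E →L[ℝ] E →L[ℝ] E, (fun p ↦ chartNewton f x₀ (chartNewtonStep f R x₀ p)
      - B (chartNewton f x₀ p) (chartNewton f x₀ p)) =o[𝓝 q] fun p ↦ ‖chartNewton f x₀ p‖ ^ 2 := by
  have hg₁ : ContDiffAt ℝ 1 (chartGrad f x₀) q := hg.of_le one_le_two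
  obtain ⟨B, hB⟩ := exists_isLittleO_chartGrad_chartNewtonStep hR hq hg hgrad hH
  have hA : Tendsto (fun p ↦ -(chartHess f x₀ (chartNewtonStep f R x₀ p)).inverse) (𝓝 q)
      (𝓝 (-(chartHess f x₀ q).inverse)) :=
    ((contDiffAt_inverse_chartHess (m := 0) hq hg₁ (by norm_num) hH).continuousAt.tendsto.comp
      (tendsto_chartNewtonStep hR hq hg₁ hgrad hH)).neg
  exact ⟨.compL ℝ E E E (-(chartHess f x₀ q).inverse) ∘L B,
    isLittleO_clm_apply_sub_clm_apply₂ hA hB⟩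

end NewtonStep

section RegularSolution

variable {E : Type*} [NormedAddCommGroup E] [NormedSpace ℝ E] [FiniteDimensional ℝ E]
  {M : Type*} [TopologicalSpace M] [ChartedSpace E M] [IsManifold 𝓘(ℝ, E) ∞ M]
  [RiemannianBundle (fun x : M ↦ TangentSpace 𝓘(ℝ, E) x)]
  [IsContMDiffRiemannianBundle 𝓘(ℝ, E) ∞ E (fun x : M ↦ TangentSpace 𝓘(ℝ, E) x)]

variable (E) in
/-- The point `x₀` is a nondegenerate critical point of `f(·, l)`, and `f` is of class `C⁴` near
`(x₀, l)`: the hypothesis on one point of a solution curve. -/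
structure IsRegularSolution (f : M × ℝ → ℝ) (x₀ : M) (l : ℝ) : Prop where
  contMDiffAt : ContMDiffAt (𝓘(ℝ, E).prod 𝓘(ℝ, ℝ)) 𝓘(ℝ, ℝ) 4 f (x₀, l)
  grad_eq_zero : grad E (fun p ↦ f (p, l)) x₀ = 0
  hess_isInvertible : (hess E (fun p ↦ f (p, l)) x₀).IsInvertible

/-- The prediction path in the chart at its starting point, together with the parameter. -/
def chartPath (f : M × ℝ → ℝ) (R : TangentBundle 𝓘(ℝ, E) M → M) (x₀ : M) (l h : ℝ) : E × ℝ :=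
  (chartRetraction R x₀ (chartAt E x₀ x₀, h • chartPrediction f x₀ (chartAt E x₀ x₀, l)), l + h)

variable {f : M × ℝ → ℝ} {R : TangentBundle 𝓘(ℝ, E) M → M} {x₀ : M} {l : ℝ}

theorem chartPath_zero (hR : IsRetraction R) :
    chartPath f R x₀ l 0 = (chartAt E x₀ x₀, l) := by
  rw [chartPath, zero_smul, hR.chartRetraction_zero (mem_chart_target E x₀), add_zero]

theorem contDiffAt_chartPath (hR : IsRetraction R) :
    ContDiffAt ℝ ∞ (chartPath (E := E) f R x₀ l) 0 := by
  refine ContDiffAt.prodMk ?_ (contDiffAt_const.add contDiffAt_id)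
  refine ContDiffAt.comp (g := chartRetraction R x₀) (0 : ℝ) ?_
    (contDiffAt_const.prodMk (contDiffAt_id.smul contDiffAt_const))
  simpa only [id_eq, zero_smul] using hR.contDiffAt_chartRetraction (mem_chart_target E x₀)

theorem hasDerivAt_chartPath (hR : IsRetraction R) :
    HasDerivAt (chartPath f R x₀ l) (chartPrediction f x₀ (chartAt E x₀ x₀, l), 1) 0 := by
  refine HasDerivAt.prodMk ?_ ((hasDerivAt_id (0 : ℝ)).const_add l)
  have hline : HasDerivAt (fun h : ℝ ↦ h • chartPrediction f x₀ (chartAt E x₀ x₀, l))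
      (chartPrediction f x₀ (chartAt E x₀ x₀, l)) 0 := by
    simpa only [id_eq, one_smul] using (hasDerivAt_id (0 : ℝ)).smul_const _
  exact (hR.hasFDerivAt_chartRetraction (mem_chart_target E x₀)).comp_hasDerivAt_of_eq 0 hline
    (zero_smul ℝ _).symm

theorem tendsto_chartPath (hR : IsRetraction R) :
    Tendsto (chartPath f R x₀ l) (𝓝 0) (𝓝 (chartAt E x₀ x₀, l)) := by
  simpa only [chartPath_zero hR] using
    (contDiffAt_chartPath (f := f) (x₀ := x₀) (l := l) hR).continuousAt.tendsto

namespace IsRegularSolution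

theorem contDiffAt_chartFun (hs : IsRegularSolution E f x₀ l) :
    ContDiffAt ℝ 4 (chartFun f x₀) (chartAt E x₀ x₀, l) := by
  refine RiemannianContinuation.contDiffAt_chartFun (mem_chart_target E x₀) ?_
  rw [chartInv_chartAt (mem_chart_source E x₀)]
  exact hs.contMDiffAt

theorem contDiffAt_chartGrad (hs : IsRegularSolution E f x₀ l) :
    ContDiffAt ℝ 3 (chartGrad f x₀) (chartAt E x₀ x₀, l) :=
  RiemannianContinuation.contDiffAt_chartGrad (mem_chart_target E x₀) hs.contDiffAt_chartFun
    (by norm_num)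

theorem chartGrad_eq_zero (hs : IsRegularSolution E f x₀ l) :
    chartGrad f x₀ (chartAt E x₀ x₀, l) = 0 := by
  rw [← chartField_grad (mem_chart_target E x₀)
    (hs.contDiffAt_chartFun.differentiableAt (by simp)), chartField,
    chartInv_chartAt (mem_chart_source E x₀), hs.grad_eq_zero, map_zero]

theorem isInvertible_chartHess (hs : IsRegularSolution E f x₀ l) :
    (chartHess f x₀ (chartAt E x₀ x₀, l)).IsInvertible := by
  rw [isInvertible_chartHess_iff (mem_chart_target E x₀)
    (hs.contDiffAt_chartFun.of_le (by norm_num)), chartInv_chartAt (mem_chart_source E x₀)]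
  exact hs.hess_isInvertible

theorem eventually_contDiffAt_chartFun (hs : IsRegularSolution E f x₀ l) :
    ∀ᶠ q in 𝓝 (chartAt E x₀ x₀, l), ContDiffAt ℝ 2 (chartFun f x₀) q :=
  (hs.contDiffAt_chartFun.of_le (by norm_num)).eventually (by simp)

theorem predictionVector_eq_chartFrame (hs : IsRegularSolution E f x₀ l) :
    predictionVector E f x₀ l
      = chartFrame x₀ x₀ (chartPrediction f x₀ (chartAt E x₀ x₀, l)) := by
  rw [← chartCoord_predictionVector (mem_chart_target E x₀)
    (hs.contDiffAt_chartFun.of_le (by norm_num)), chartInv_chartAt (mem_chart_source E x₀),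
    chartFrame_chartCoord (mem_chart_source E x₀)]

theorem fderiv_chartGrad_chartPrediction (hs : IsRegularSolution E f x₀ l) :
    fderiv ℝ (chartGrad f x₀) (chartAt E x₀ x₀, l)
      (chartPrediction f x₀ (chartAt E x₀ x₀, l), 1) = 0 := by
  set q : E × ℝ := (chartAt E x₀ x₀, l)
  have hprediction : chartHess f x₀ q (chartPrediction f x₀ q)
      = -fderiv ℝ (chartGrad f x₀) q (0, 1) := by
    rw [chartPrediction, map_neg, ← hs.isInvertible_chartHess.inverse_apply_eq.1 rfl]
  have hhess (v : E) : chartHess f x₀ q v = fderiv ℝ (chartGrad f x₀) q (v, 0) := by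
    simp [chartHess, q, hs.chartGrad_eq_zero]
  rw [← add_zero (chartPrediction f x₀ q), ← zero_add (1 : ℝ), ← Prod.mk_add_mk, map_add, ← hhess,
    hprediction, neg_add_cancel]

theorem exists_isBigO_chartGrad (hs : IsRegularSolution E f x₀ l) (hR : IsRetraction R) :
    ∃ a : E, (fun h ↦ chartGrad f x₀ (chartPath f R x₀ l h) - h ^ 2 • a)
      =O[𝓝 0] fun h ↦ h ^ 3 := by
  have hgrad := hs.contDiffAt_chartGrad
  rw [← chartPath_zero (f := f) hR] at hgrad
  refine exists_isBigO_sub_sq_smul (g := fun h ↦ chartGrad f x₀ (chartPath f R x₀ l h))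
    (ContDiffAt.comp (0 : ℝ) hgrad ((contDiffAt_chartPath hR).of_le ENat.LEInfty.out)) ?_ ?_
  · rw [chartPath_zero hR, hs.chartGrad_eq_zero]
  · have hderiv := (hgrad.differentiableAt (by simp)).hasFDerivAt.comp_hasDerivAt (0 : ℝ)
      (hasDerivAt_chartPath (f := f) (x₀ := x₀) (l := l) hR)
    rw [chartPath_zero hR, hs.fderiv_chartGrad_chartPrediction] at hderiv
    exact hderiv.deriv

theorem exists_isBigO_chartNewton (hs : IsRegularSolution E f x₀ l) (hR : IsRetraction R) :
    ∃ v : E, (fun h ↦ chartNewton f x₀ (chartPath f R x₀ l h) - h ^ 2 • v)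
      =O[𝓝 0] fun h ↦ h ^ 3 := by
  obtain ⟨a, ha⟩ := hs.exists_isBigO_chartGrad hR
  have hinv := contDiffAt_inverse_chartHess (m := 2) (mem_chart_target E x₀)
    hs.contDiffAt_chartGrad (by norm_num) hs.isInvertible_chartHess
  rw [← chartPath_zero (f := f) hR] at hinv
  have hA : DifferentiableAt ℝ (fun h ↦ -(chartHess f x₀ (chartPath f R x₀ l h)).inverse) 0 :=
    (DifferentiableAt.comp (0 : ℝ) (hinv.differentiableAt (by simp))
      ((contDiffAt_chartPath hR).differentiableAt (by simp))).neg
  exact ⟨_, isBigO_clm_apply_sub_pow_smul (hA.isBigO_sub.congr_right sub_zero) ha⟩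

end IsRegularSolution

end RegularSolution

section Contraction

variable {E : Type*} [NormedAddCommGroup E] [NormedSpace ℝ E] [FiniteDimensional ℝ E]
  {M : Type*} [TopologicalSpace M] [ChartedSpace E M] [IsManifold 𝓘(ℝ, E) ∞ M]
  [RiemannianBundle (fun x : M ↦ TangentSpace 𝓘(ℝ, E) x)]
  [IsContMDiffRiemannianBundle 𝓘(ℝ, E) ∞ E (fun x : M ↦ TangentSpace 𝓘(ℝ, E) x)]
  {f : M × ℝ → ℝ} {R : TangentBundle 𝓘(ℝ, E) M → M} {x₀ : M} {l : ℝ}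

theorem norm_newtonVector {q : E × ℝ} (hq : q.1 ∈ (chartAt E x₀).target)
    (hf : ContDiffAt ℝ 2 (chartFun f x₀) q) :
    ‖newtonVector E f (chartInv x₀ q.1) q.2‖ = chartNorm x₀ q.1 (chartNewton f x₀ q) := by
  rw [← chartCoord_newtonVector hq hf, chartNorm_chartCoord hq]

theorem mk_newtonVector {q : E × ℝ} (hq : q.1 ∈ (chartAt E x₀).target)
    (hf : ContDiffAt ℝ 2 (chartFun f x₀) q) :
    (⟨chartInv x₀ q.1, newtonVector E f (chartInv x₀ q.1) q.2⟩ : TangentBundle 𝓘(ℝ, E) M)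
      = chartVector x₀ (q.1, chartNewton f x₀ q) := by
  rw [chartVector, ← chartCoord_newtonVector hq hf, chartFrame_chartCoord (chartInv_mem_source hq)]

namespace IsRegularSolution

theorem eventually_predictionPath (hs : IsRegularSolution E f x₀ l) (hR : IsRetraction R) :
    ∀ᶠ h in 𝓝 0, predictionPath f R x₀ l h = chartInv x₀ (chartPath f R x₀ l h).1 := by
  have hline : Tendsto
      (fun h : ℝ ↦ (chartAt E x₀ x₀, h • chartPrediction f x₀ (chartAt E x₀ x₀, l)))
      (𝓝 0) (𝓝 (chartAt E x₀ x₀, 0)) :=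
    Continuous.tendsto' (by fun_prop) _ _ (by rw [zero_smul])
  filter_upwards [hline.eventually
    (hR.eventually_chartInv_chartRetraction (mem_chart_target E x₀))] with h hh
  rw [chartPath, hh, chartVector_chart_self, map_smul, ← hs.predictionVector_eq_chartFrame,
    predictionPath]

theorem eventually_norm_newtonVector (hs : IsRegularSolution E f x₀ l) :
    ∀ᶠ q in 𝓝 (chartAt E x₀ x₀, l), ‖newtonVector E f (chartInv x₀ q.1) q.2‖
      = chartNorm x₀ q.1 (chartNewton f x₀ q) := by
  filter_upwards [hs.eventually_contDiffAt_chartFun,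
    continuousAt_fst.preimage_mem_nhds (chart_target_mem_nhds (mem_chart_target E x₀))] with q hf hq
  exact norm_newtonVector hq hf

theorem eventually_map_newtonVector (hs : IsRegularSolution E f x₀ l) (hR : IsRetraction R) :
    ∀ᶠ q in 𝓝 (chartAt E x₀ x₀, l), R ⟨chartInv x₀ q.1, newtonVector E f (chartInv x₀ q.1) q.2⟩
      = chartInv x₀ (chartNewtonStep f R x₀ q).1 := by
  have hN := tendsto_chartNewton_nhds_zero (mem_chart_target E x₀)
    (hs.contDiffAt_chartGrad.of_le (by norm_num)) hs.chartGrad_eq_zero hs.isInvertible_chartHess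
  filter_upwards [hs.eventually_contDiffAt_chartFun,
    continuousAt_fst.preimage_mem_nhds (chart_target_mem_nhds (mem_chart_target E x₀)),
    (continuousAt_fst.tendsto.prodMk_nhds hN).eventually
      (hR.eventually_chartInv_chartRetraction (mem_chart_target E x₀))] with q hf hq hretr
  rw [mk_newtonVector hq hf, chartNewtonStep, hretr]

theorem eventually_delta_eq (hs : IsRegularSolution E f x₀ l) (hR : IsRetraction R) :
    ∀ᶠ h in 𝓝 0, delta f R x₀ l h
      = chartNorm x₀ (chartPath f R x₀ l h).1 (chartNewton f x₀ (chartPath f R x₀ l h)) := by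
  filter_upwards [hs.eventually_predictionPath hR,
    (tendsto_chartPath hR).eventually hs.eventually_norm_newtonVector] with h hpath hnorm
  rw [delta, firstUpdate, hpath]
  exact hnorm

theorem tendsto_chartNewtonStep (hs : IsRegularSolution E f x₀ l) (hR : IsRetraction R) :
    Tendsto (chartNewtonStep f R x₀) (𝓝 (chartAt E x₀ x₀, l)) (𝓝 (chartAt E x₀ x₀, l)) :=
  RiemannianContinuation.tendsto_chartNewtonStep hR (mem_chart_target E x₀)
    (hs.contDiffAt_chartGrad.of_le (by norm_num)) hs.chartGrad_eq_zero hs.isInvertible_chartHess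

theorem tendsto_chartNewtonStep_chartPath (hs : IsRegularSolution E f x₀ l) (hR : IsRetraction R) :
    Tendsto (fun h ↦ chartNewtonStep f R x₀ (chartPath f R x₀ l h)) (𝓝 0)
      (𝓝 (chartAt E x₀ x₀, l)) :=
  (hs.tendsto_chartNewtonStep hR).comp (tendsto_chartPath hR)

theorem eventually_kappa_eq (hs : IsRegularSolution E f x₀ l) (hR : IsRetraction R) :
    ∀ᶠ h in 𝓝 0, kappa f R x₀ l h
      = chartNorm x₀ (chartNewtonStep f R x₀ (chartPath f R x₀ l h)).1
          (chartNewton f x₀ (chartNewtonStep f R x₀ (chartPath f R x₀ l h)))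
        / chartNorm x₀ (chartPath f R x₀ l h).1 (chartNewton f x₀ (chartPath f R x₀ l h)) := by
  filter_upwards [hs.eventually_predictionPath hR, hs.eventually_delta_eq hR,
    (tendsto_chartPath hR).eventually (hs.eventually_map_newtonVector hR),
    (hs.tendsto_chartNewtonStep_chartPath hR).eventually hs.eventually_norm_newtonVector]
    with h hpath hdelta hstep hnorm
  have hiterate : firstIterate f R x₀ l h
      = chartInv x₀ (chartNewtonStep f R x₀ (chartPath f R x₀ l h)).1 := by
    rw [firstIterate, firstUpdate, hpath]
    exact hstep
  rw [kappa, ← delta, hdelta, hiterate]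
  exact congrArg (· / _) hnorm

theorem exists_isBigO_delta (hs : IsRegularSolution E f x₀ l) (hR : IsRetraction R) :
    ∃ d : ℝ, (fun h ↦ delta f R x₀ l h - d * h ^ 2) =O[𝓝[>] 0] fun h ↦ h ^ 3 := by
  obtain ⟨v, hv⟩ := hs.exists_isBigO_chartNewton hR
  have hpath := ((contDiffAt_chartPath (f := f) (x₀ := x₀) (l := l) hR).differentiableAt
    (by simp)).fst
  refine ⟨chartNorm x₀ (chartAt E x₀ x₀) v, (isBigO_chartNorm_sub hpath
    (congrArg Prod.fst (chartPath_zero hR)) (hv.mono nhdsWithin_le_nhds)).congr' ?_ .rfl⟩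
  filter_upwards [nhdsWithin_le_nhds (hs.eventually_delta_eq hR)] with h hdelta
  rw [hdelta]

theorem exists_isLittleO_chartNewton (hs : IsRegularSolution E f x₀ l) (hR : IsRetraction R) :
    ∃ B : E →L[ℝ] E →L[ℝ] E,
      (fun h ↦ chartNewton f x₀ (chartNewtonStep f R x₀ (chartPath f R x₀ l h))
        - B (chartNewton f x₀ (chartPath f R x₀ l h)) (chartNewton f x₀ (chartPath f R x₀ l h)))
      =o[𝓝 0] fun h ↦ ‖chartNewton f x₀ (chartPath f R x₀ l h)‖ ^ 2 := by
  obtain ⟨B, hB⟩ := exists_isLittleO_chartNewton_chartNewtonStep hR (mem_chart_target E x₀)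
    (hs.contDiffAt_chartGrad.of_le (by norm_num)) hs.chartGrad_eq_zero hs.isInvertible_chartHess
  exact ⟨B, hB.comp_tendsto (tendsto_chartPath hR)⟩

theorem exists_isLittleO_chartNewton_iterate (hs : IsRegularSolution E f x₀ l)
    (hR : IsRetraction R) {v : E}
    (hv : (fun h ↦ chartNewton f x₀ (chartPath f R x₀ l h) - h ^ 2 • v) =o[𝓝[>] 0] fun h ↦ h ^ 2) :
    ∃ w : E, (fun h ↦ chartNewton f x₀ (chartNewtonStep f R x₀ (chartPath f R x₀ l h)) - h ^ 4 • w)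
      =o[𝓝[>] 0] fun h ↦ h ^ 4 := by
  obtain ⟨B, hB⟩ := hs.exists_isLittleO_chartNewton hR
  have hrest := (hB.mono nhdsWithin_le_nhds).trans_isBigO
    ((isBigO_of_isLittleO_sub_pow_smul hv).norm_left.pow 2)
  simp only [← pow_mul] at hrest
  refine ⟨B v v, (hrest.add (isLittleO_clm_apply₂_sub_pow_smul (B := B) hv)).congr_left fun h ↦ ?_⟩
  exact sub_add_sub_cancel _ _ _

theorem isLittleO_kappa_of_isBigO (hs : IsRegularSolution E f x₀ l) (hR : IsRetraction R)
    (hN : (fun h ↦ chartNewton f x₀ (chartPath f R x₀ l h)) =O[𝓝[>] 0] fun h ↦ h ^ 3) :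
    kappa f R x₀ l =o[𝓝[>] 0] fun h ↦ h ^ 2 := by
  obtain ⟨B, hB⟩ := hs.exists_isLittleO_chartNewton hR
  set c := chartPath f R x₀ l
  have hpath : Tendsto (fun h ↦ (c h).1) (𝓝[>] 0) (𝓝 (chartAt E x₀ x₀)) :=
    ((tendsto_chartPath hR).mono_left nhdsWithin_le_nhds).fst_nhds
  have hstep : Tendsto (fun h ↦ (chartNewtonStep f R x₀ (c h)).1) (𝓝[>] 0)
      (𝓝 (chartAt E x₀ x₀)) :=
    ((hs.tendsto_chartNewtonStep_chartPath hR).mono_left nhdsWithin_le_nhds).fst_nhds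
  have hquad : (fun h ↦ chartNewton f x₀ (chartNewtonStep f R x₀ (c h)))
      =O[𝓝[>] 0] fun h ↦ ‖chartNewton f x₀ (c h)‖ ^ 2 := by
    simpa using (hB.mono nhdsWithin_le_nhds).isBigO.add (isBigO_clm_apply₂ B _)
  have hnum := (isBigO_chartNorm hstep _).trans
    (hquad.trans ((isBigO_of_chartNorm hpath fun h ↦ chartNewton f x₀ (c h)).norm_left.pow 2))
  have hden := (isBigO_chartNorm hpath fun h ↦ chartNewton f x₀ (c h)).trans hN
  -- Where the first update vanishes, so does the second, and `κ = 0 / 0 = 0`.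
  refine IsLittleO.congr' (((isBigO_div_of_isBigO_sq hnum).trans hden).trans_isLittleO
    ((isLittleO_pow_pow (Nat.lt_succ_self 2)).mono nhdsWithin_le_nhds)) ?_ .rfl
  filter_upwards [nhdsWithin_le_nhds (hs.eventually_kappa_eq hR)] with h hkappa
  rw [hkappa]

theorem exists_isLittleO_kappa (hs : IsRegularSolution E f x₀ l) (hR : IsRetraction R) :
    ∃ k : ℝ, (fun h ↦ kappa f R x₀ l h - k * h ^ 2) =o[𝓝[>] 0] fun h ↦ h ^ 2 := by
  obtain ⟨v, hv⟩ := hs.exists_isBigO_chartNewton hR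
  replace hv := hv.mono (nhdsWithin_le_nhds (s := Ioi 0))
  rcases eq_or_ne v 0 with rfl | hv₀
  · refine ⟨0, ?_⟩
    simpa using hs.isLittleO_kappa_of_isBigO hR (by simpa using hv)
  have hv' := hv.trans_isLittleO
    ((isLittleO_pow_pow (𝕜 := ℝ) (Nat.lt_succ_self 2)).mono nhdsWithin_le_nhds)
  obtain ⟨w, hw⟩ := hs.exists_isLittleO_chartNewton_iterate hR hv'
  have hpath := ((tendsto_chartPath (f := f) (x₀ := x₀) (l := l) hR).mono_left
    (nhdsWithin_le_nhds (s := Ioi 0))).fst_nhds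
  have hstep := ((hs.tendsto_chartNewtonStep_chartPath hR).mono_left
    (nhdsWithin_le_nhds (s := Ioi 0))).fst_nhds
  refine ⟨chartNorm x₀ (chartAt E x₀ x₀) w / chartNorm x₀ (chartAt E x₀ x₀) v,
    (isLittleO_div_sub_mul_pow (chartNorm_pos (mem_chart_target E x₀) hv₀).ne'
    (isLittleO_chartNorm_sub hstep hw) (isLittleO_chartNorm_sub hpath hv')).congr' ?_ .rfl⟩
  filter_upwards [nhdsWithin_le_nhds (hs.eventually_kappa_eq hR)] with h hkappa
  rw [hkappa]

end IsRegularSolution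

end Contraction

section Angle

variable {F : Type*} [NormedAddCommGroup F] [InnerProductSpace ℝ F]

theorem arccos_inner_normalize (x y : F) :
    Real.arccos (inner ℝ (‖x‖⁻¹ • x) (‖y‖⁻¹ • y)) = InnerProductGeometry.angle x y := by
  rw [real_inner_smul_left, real_inner_smul_right, InnerProductGeometry.angle]
  congr 1
  ring

theorem angle_eq_arctan {x y : F} (h : 0 < inner ℝ x y) :
    InnerProductGeometry.angle x y
      = Real.arctan ‖(‖x‖ / inner ℝ x y) • y - ‖x‖⁻¹ • x‖ := by
  have hx : x ≠ 0 := by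
    rintro rfl
    simp at h
  have hnorm : 0 < ‖x‖ := norm_pos_iff.2 hx
  have hunit : ‖‖x‖⁻¹ • x‖ = 1 := norm_smul_inv_norm (𝕜 := ℝ) hx
  have horth : inner ℝ (‖x‖⁻¹ • x) ((‖x‖ / inner ℝ x y) • y - ‖x‖⁻¹ • x) = (0 : ℝ) := by
    rw [inner_sub_right, real_inner_self_eq_norm_sq, hunit, real_inner_smul_left,
      real_inner_smul_right]
    field_simp
    ring
  have harctan := InnerProductGeometry.angle_add_eq_arctan_of_inner_eq_zero horth
    (norm_ne_zero_iff.1 (by simp [hunit]))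
  rwa [add_sub_cancel, hunit, div_one,
    InnerProductGeometry.angle_smul_left_of_pos _ _ (inv_pos.2 hnorm),
    InnerProductGeometry.angle_smul_right_of_pos _ _ (div_pos hnorm h)] at harctan

theorem isBigO_norm_sub_mul {G : Type*} [NormedAddCommGroup G] [NormedSpace ℝ G] {g : ℝ → G}
    (hg : ContDiffAt ℝ 2 g 0) (h0 : g 0 = 0) :
    (fun h ↦ ‖g h‖ - ‖deriv g 0‖ * h) =O[𝓝[>] 0] fun h ↦ h ^ 2 := by
  refine IsBigO.trans (.of_bound' ?_) ((isBigO_sub_smul_deriv hg h0).mono nhdsWithin_le_nhds)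
  filter_upwards [self_mem_nhdsWithin] with h (hh : 0 < h)
  rw [mul_comm, ← Real.norm_of_nonneg hh.le, ← norm_smul, Real.norm_of_nonneg hh.le]
  exact abs_norm_sub_norm_le _ _

theorem isBigO_arctan_sub_self : (fun x ↦ Real.arctan x - x) =O[𝓝 0] fun x ↦ x ^ 2 := by
  simpa [Real.deriv_arctan] using
    isBigO_sub_smul_deriv (g := Real.arctan) Real.contDiff_arctan.contDiffAt Real.arctan_zero

theorem isBigO_arctan_norm_sub_mul {G : Type*} [NormedAddCommGroup G] [NormedSpace ℝ G] {g : ℝ → G}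
    (hg : ContDiffAt ℝ 2 g 0) (h0 : g 0 = 0) :
    (fun h ↦ Real.arctan ‖g h‖ - ‖deriv g 0‖ * h) =O[𝓝[>] 0] fun h ↦ h ^ 2 := by
  have hlin : (fun h ↦ ‖g h‖) =O[𝓝 0] fun h ↦ h := by
    simpa [h0] using (hg.differentiableAt (by simp)).isBigO_sub.norm_left
  have harctan := ((isBigO_arctan_sub_self.comp_tendsto (hlin.trans_tendsto tendsto_id)).trans
    (hlin.pow 2)).mono (nhdsWithin_le_nhds (s := Ioi 0))
  exact (harctan.add (isBigO_norm_sub_mul hg h0)).congr_left fun h ↦ sub_add_sub_cancel _ _ _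

theorem exists_isBigO_angle_sub {τ : ℝ → F} (hτ : ContDiffAt ℝ 2 τ 0) (h0 : τ 0 ≠ 0) :
    ∃ c : ℝ, (fun h ↦ InnerProductGeometry.angle (τ 0) (τ h) - c * h)
      =O[𝓝[>] 0] fun h ↦ h ^ 2 := by
  have hinner : ContDiffAt ℝ 2 (fun h ↦ inner ℝ (τ 0) (τ h)) 0 := contDiffAt_const.inner ℝ hτ
  have hpos : 0 < inner ℝ (τ 0) (τ 0) := real_inner_self_pos.2 h0
  let tangent (h : ℝ) : F := (‖τ 0‖ / inner ℝ (τ 0) (τ h)) • τ h - ‖τ 0‖⁻¹ • τ 0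
  have htangent : ContDiffAt ℝ 2 tangent 0 :=
    ((contDiffAt_const.div hinner hpos.ne').smul hτ).sub contDiffAt_const
  have htangent₀ : tangent 0 = 0 := by
    have : ‖τ 0‖ ≠ 0 := norm_ne_zero_iff.2 h0
    rw [sub_eq_zero, real_inner_self_eq_norm_sq]
    congr 1
    field_simp
  refine ⟨‖deriv tangent 0‖, (isBigO_arctan_norm_sub_mul htangent htangent₀).congr' ?_ .rfl⟩
  filter_upwards [nhdsWithin_le_nhds (hinner.continuousAt.eventually (lt_mem_nhds hpos))] with h hh
  rw [angle_eq_arctan hh]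

end Angle

section Transport

variable {E : Type*} [NormedAddCommGroup E] [NormedSpace ℝ E] [FiniteDimensional ℝ E]
  {M : Type*} [TopologicalSpace M] [ChartedSpace E M] [IsManifold 𝓘(ℝ, E) ∞ M]
  [RiemannianBundle (fun x : M ↦ TangentSpace 𝓘(ℝ, E) x)]
  [IsContMDiffRiemannianBundle 𝓘(ℝ, E) ∞ E (fun x : M ↦ TangentSpace 𝓘(ℝ, E) x)]
  {f : M × ℝ → ℝ} {R : TangentBundle 𝓘(ℝ, E) M → M}
  {T : Π y x : M, TangentSpace 𝓘(ℝ, E) y →L[ℝ] TangentSpace 𝓘(ℝ, E) x} {x₀ : M} {l : ℝ}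

theorem transportedPrediction_zero (hR : IsRetraction R) (hT : IsVectorTransport T) :
    transportedPrediction f R T x₀ l 0 = predictionVector E f x₀ l := by
  have hpath : predictionPath f R x₀ l 0 = x₀ := by
    rw [predictionPath, zero_smul, hR.map_zero]
  have htransport (p : M) (hp : p = x₀) :
      T p x₀ (predictionVector E f p (l + 0)) = predictionVector E f x₀ l := by
    subst hp
    rw [hT.map_self, add_zero]
    rfl
  exact htransport _ hpath

namespace IsRegularSolution

theorem eventually_predictionVector_eq (hs : IsRegularSolution E f x₀ l) :
    ∀ᶠ q in 𝓝 (chartAt E x₀ x₀, l), predictionVector E f (chartInv x₀ q.1) q.2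
      = chartFrame x₀ (chartInv x₀ q.1) (chartPrediction f x₀ q) := by
  filter_upwards [hs.eventually_contDiffAt_chartFun,
    continuousAt_fst.preimage_mem_nhds (chart_target_mem_nhds (mem_chart_target E x₀))] with q hf hq
  rw [← chartCoord_predictionVector hq hf, chartFrame_chartCoord (chartInv_mem_source hq)]

theorem contDiffAt_transportedPrediction (hs : IsRegularSolution E f x₀ l) (hR : IsRetraction R)
    (hT : IsVectorTransport T) :
    ContDiffAt ℝ 2 (fun h ↦ transportedPrediction f R T x₀ l h) 0 := by
  set c := chartPath f R x₀ l
  have hc₀ : c 0 = (chartAt E x₀ x₀, l) := chartPath_zero hR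
  have hcdiff : ContDiffAt ℝ 2 c 0 := (contDiffAt_chartPath hR).of_le ENat.LEInfty.out
  have hprediction := contDiffAt_chartPrediction (m := 2) (mem_chart_target E x₀)
    hs.contDiffAt_chartGrad (by norm_num) hs.isInvertible_chartHess
  have htransport := (hT.contDiffAt_chartCoord x₀
    (chartPrediction f x₀ (chartAt E x₀ x₀, l))).of_le (m := 2) ENat.LEInfty.out
  rw [show (chartAt E x₀ x₀, chartPrediction f x₀ (chartAt E x₀ x₀, l))
    = ((c 0).1, chartPrediction f x₀ (c 0)) by rw [hc₀]] at htransport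
  rw [← hc₀] at hprediction
  have hcoord := ContDiffAt.comp (0 : ℝ) htransport
    (hcdiff.fst.prodMk (ContDiffAt.comp (0 : ℝ) hprediction hcdiff))
  have hframe := ContinuousLinearMap.contDiff (n := 2) (E := E) (F := TangentSpace 𝓘(ℝ, E) x₀)
    (chartFrame x₀ x₀)
  refine (ContDiffAt.comp (F := E) (G := TangentSpace 𝓘(ℝ, E) x₀) (0 : ℝ)
    hframe.contDiffAt hcoord).congr_of_eventuallyEq ?_
  filter_upwards [hs.eventually_predictionPath hR,
    (tendsto_chartPath hR).eventually hs.eventually_predictionVector_eq] with h hpath hvector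
  rw [transportedPrediction, hpath]
  exact (congrArg (T _ x₀) hvector).trans (chartFrame_chartCoord (mem_chart_source E x₀) _).symm

theorem exists_isBigO_alpha (hs : IsRegularSolution E f x₀ l) (hR : IsRetraction R)
    (hT : IsVectorTransport T) (ht : predictionVector E f x₀ l ≠ 0) :
    ∃ a : ℝ, (fun h ↦ alpha f R T x₀ l h - a * h) =O[𝓝[>] 0] fun h ↦ h ^ 2 := by
  have ht₀ := transportedPrediction_zero (f := f) (x₀ := x₀) (l := l) hR hT
  simpa only [alpha, arccos_inner_normalize, ht₀] using
    exists_isBigO_angle_sub (hs.contDiffAt_transportedPrediction hR hT) (ht₀ ▸ ht)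

end IsRegularSolution

end Transport

end

end RiemannianContinuation

section Expansions

variable {E : Type*} [NormedAddCommGroup E] [NormedSpace ℝ E] [FiniteDimensional ℝ E]
  {M : Type*} [TopologicalSpace M] [ChartedSpace E M] [IsManifold 𝓘(ℝ, E) ∞ M]
  [RiemannianBundle (fun x : M ↦ TangentSpace 𝓘(ℝ, E) x)]
  [IsContMDiffRiemannianBundle 𝓘(ℝ, E) ∞ E (fun x : M ↦ TangentSpace 𝓘(ℝ, E) x)]

open RiemannianContinuation in
theorem lemma3p4_general (f : M × ℝ → ℝ) {R : TangentBundle 𝓘(ℝ, E) M → M} (hR : IsRetraction R)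
    {T : Π y x : M, TangentSpace 𝓘(ℝ, E) y →L[ℝ] TangentSpace 𝓘(ℝ, E) x}
    (hT : IsVectorTransport T) :
    ∃ δ₂ κ₂ α₁ : M → ℝ → ℝ, ∀ (x₀ : M) (l : ℝ), IsRegularSolution E f x₀ l →
      ((fun h ↦ delta f R x₀ l h - δ₂ x₀ l * h ^ 2) =O[𝓝[>] 0] fun h ↦ h ^ 3) ∧
      ((fun h ↦ kappa f R x₀ l h - κ₂ x₀ l * h ^ 2) =o[𝓝[>] 0] fun h ↦ h ^ 2) ∧
      (predictionVector E f x₀ l ≠ 0 →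
        (fun h ↦ alpha f R T x₀ l h - α₁ x₀ l * h) =O[𝓝[>] 0] fun h ↦ h ^ 2) := by
  choose! δ₂ hδ using fun x₀ l (hs : IsRegularSolution E f x₀ l) ↦ hs.exists_isBigO_delta hR
  choose! κ₂ hκ using fun x₀ l (hs : IsRegularSolution E f x₀ l) ↦ hs.exists_isLittleO_kappa hR
  choose! α₁ hα using fun x₀ l (hs : IsRegularSolution E f x₀ l) ↦ hs.exists_isBigO_alpha hR hT
  exact ⟨δ₂, κ₂, α₁, fun x₀ l hs ↦ ⟨hδ x₀ l hs, hκ x₀ l hs, hα x₀ l hs⟩⟩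

end Expansions

open RiemannianContinuation in
theorem lemma3p4 {E : Type*} [NormedAddCommGroup E] [NormedSpace ℝ E] [FiniteDimensional ℝ E]
    {M : Type*} [TopologicalSpace M] [ChartedSpace E M] [IsManifold 𝓘(ℝ, E) ∞ M]
    [RiemannianBundle (fun x : M ↦ TangentSpace 𝓘(ℝ, E) x)]
    [IsContMDiffRiemannianBundle 𝓘(ℝ, E) ∞ E (fun x : M ↦ TangentSpace 𝓘(ℝ, E) x)]
    (V : Set (M × ℝ)) (hV : IsOpen V)
    (f : M × ℝ → ℝ) (hf : ContMDiffOn (𝓘(ℝ, E).prod 𝓘(ℝ, ℝ)) 𝓘(ℝ, ℝ) 4 f V)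
    (R : TangentBundle 𝓘(ℝ, E) M → M) (hR : IsRetraction R)
    (T : Π y x : M, TangentSpace 𝓘(ℝ, E) y →L[ℝ] TangentSpace 𝓘(ℝ, E) x)
    (hT : IsVectorTransport T)
    (x : ℝ → M) (hx : IsSolutionCurve (E := E) V f x)
    (hnd : ∀ l ∈ Icc (0 : ℝ) 1,
      covDerivAlong (predictionPath f R (x l) l)
        (covDerivAlong (predictionPath f R (x l) l) (firstUpdate f R (x l) l)) 0 ≠ 0) :
    ∃ δ₂ κ₂ α₁ : M → ℝ → ℝ, ∀ l ∈ Icc (0 : ℝ) 1,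
      ((fun h : ℝ ↦ delta f R (x l) l h - δ₂ (x l) l * h ^ 2) =O[𝓝[>] 0] fun h ↦ h ^ 3) ∧
      ((fun h : ℝ ↦ kappa f R (x l) l h - κ₂ (x l) l * h ^ 2) =o[𝓝[>] 0] fun h ↦ h ^ 2) ∧
      (predictionVector E f (x l) l ≠ 0 →
        (fun h : ℝ ↦ alpha f R T (x l) l h - α₁ (x l) l * h) =O[𝓝[>] 0] fun h ↦ h ^ 2) := by
  obtain ⟨δ₂, κ₂, α₁, h⟩ := lemma3p4_general f hR hT
  exact ⟨δ₂, κ₂, α₁, fun l hl ↦ h (x l) l ⟨hf.contMDiffAt (hV.mem_nhds (hx.mem l hl)),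
    hx.grad_eq_zero l hl, hx.hess_isInvertible l hl⟩⟩
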